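/- **Theorem (Limiting Absorption Principle, Hölder continuity).** Let $L\in\mathbb N$, let $\mathcal M_L$ be the space of complex $L\times L$ matrices with the Frobenius inner product, and let $V=(V(n))_{n\in\mathbb Z}$ be a sequence of self-adjoint matrices in $\mathcal M_L$ with $\sum_n\|V(n)\|<\infty$, where $\|V(n)\|$ is the norm of $V(n)$ as a multiplication operator on $\mathcal M_L$. Let $H$ be the bounded operator on $\ell^2(\mathbb Z,\mathcal M_L)$ given by $$(Hu)(n)=u(n+1)+u(n-1)+V(n)u(n),$$ let $\sigma(H)$ be its spectrum, $\sigma_p(H)$ the set of its eigenvalues, and $R_H(E)=(H-E)^{-1}$ for $E\notin\sigma(H)$. For a bounded operator $T$ on $\ell^2(\mathbb Z,\mathcal M_L)$ let $[T]_{s,r}=\pi_sT\pi_r^*\in B(\mathcal M_L)$ be its matrix elements, where $\pi_su=u(s)$. For a sign $\pm$ and $E$ in the closed half-plane $\overline{\mathbb C^\pm}=\{E:\pm\operatorname{Im}E\ge0\}$ with $E\notin\sigma_p(H)\cup\{-2,2\}$, put $$[R_H^\pm(E)]_{s,r}=\begin{cases}[R_H(E)]_{s,r}, & E\notin(-2,2),\\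 \lim_{\varepsilon\to0^+}[R_H(E\pm i\varepsilon)]_{s,r}, & E\in(-2,2),\end{cases}$$ and let $R_H^\pm(E)$ be the integral operator $(R^\pm_H(E)u)(s)=\sum_r[R_H^\pm(E)]_{s,r}u(r)$, whose domain is the set of all sequences $u$ with $\sum_r\|[R_H^\pm(E)]_{s,r}u(r)\|<\infty$ for every $s$. Let $(T_{-\alpha}u)(n)=(1+|n|)^{-\alpha}u(n)$. Let $r_\pm(E)$ be, for $E\in\mathbb C\setminus[-2,2]$, the unique $z$ with $0<|z|<1$ and $z+1/z=E$, and let $r_\pm(2\cos k)=e^{\mp ik}$ for $k\in[0,\pi]$. Suppose that $\rho>0$, $\|V\|_\rho:=\sum_n(1+|n|)^\rho\|V(n)\|<\infty$ and $\alpha>\rho+\tfrac12$, and let $K^\pm\subset\overline{\mathbb C^\pm}\setminus(\sigma_p(H)\cup\{-2,2\})$ be compact. Then $R_H^\pm(E)$ is well defined for every $E\in K^\pm$ (that is, $E\notin\sigma(H)$ if $E\notin(-2,2)$; and if $E\in(-2,2)$, then $E\pm i\varepsilon\notin\sigma(H)$ for all $\varepsilon>0$ and the limits above exist), $T_{-\alpha}R_H^\pm(E)T_{-\alpha}$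 is a bounded operator on $\ell^2(\mathbb Z,\mathcal M_L)$ for every $E\in K^\pm$, and the map $$K^\pm\ni E\mapsto T_{-\alpha}R_H^\pm(E)T_{-\alpha}\in B(\ell^2(\mathbb Z,\mathcal M_L))$$ is Hölder continuous with exponent $\min(\rho,1)$. Moreover, there is a constant $C$ such that, for all $E,E_0\in K^\pm$, $$\|T_{-\alpha}R_H^\pm(E)T_{-\alpha}-T_{-\alpha}R_H^\pm(E_0)T_{-\alpha}\|\le C\,|r_\pm(E)-r_\pm(E_0)|^{\min(\rho,1)}.$$ -/

import Mathlib

open Filter Topology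

/-- `M_L`: complex `L × L` matrices. It is a type of its own so that it carries the norm and the
topology given below, and no other. -/
def MatL (L : ℕ) : Type := Matrix (Fin L) (Fin L) ℂ

/-- The norm of `M_L` is the Frobenius norm `‖A‖ = (tr (A* A))^{1/2}`. -/
noncomputable instance (L : ℕ) : NormedAddCommGroup (MatL L) :=
  (Matrix.frobeniusNormedAddCommGroup : NormedAddCommGroup (Matrix (Fin L) (Fin L) ℂ))

noncomputable instance (L : ℕ) : NormedSpace ℂ (MatL L) :=
  (Matrix.frobeniusNormedSpace : @NormedSpace ℂ (Matrix (Fin L) (Fin L) ℂ) _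
    Matrix.frobeniusSeminormedAddCommGroup)

theorem MatL.norm_sq {L : ℕ} (A : MatL L) : ‖A‖ ^ 2 = ∑ i : Fin L, ∑ j : Fin L, ‖A i j‖ ^ 2 := by
  have h : ‖A‖ = (∑ i, ∑ j, ‖A i j‖ ^ (2 : ℝ)) ^ (1 / 2 : ℝ) :=
    Matrix.frobenius_norm_def (show Matrix (Fin L) (Fin L) ℂ from A)
  rw [h, ← Real.sqrt_eq_rpow, Real.sq_sqrt (by positivity)]
  norm_cast

/-- The matrix product. -/
noncomputable instance (L : ℕ) : Mul (MatL L) :=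
  inferInstanceAs (Mul (Matrix (Fin L) (Fin L) ℂ))

theorem MatL.norm_mul_le {L : ℕ} (A B : MatL L) : ‖A * B‖ ≤ ‖A‖ * ‖B‖ :=
  Matrix.frobenius_norm_mul (show Matrix (Fin L) (Fin L) ℂ from A)
    (show Matrix (Fin L) (Fin L) ℂ from B)

/-- `ℓ²(ℤ, M_L)`. -/
abbrev EllTwo (L : ℕ) : Type := lp (fun _ : ℤ => MatL L) 2

/-- The operator of left multiplication by `A` on `M_L`, an element of `B(M_L)`. -/
noncomputable def leftMul {L : ℕ} (A : MatL L) : MatL L →L[ℂ] MatL L :=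
  LinearMap.mkContinuous
    { toFun := fun B => A * B
      map_add' := fun B C => Matrix.mul_add (show Matrix (Fin L) (Fin L) ℂ from A) B C
      map_smul' := fun c B => Matrix.mul_smul (show Matrix (Fin L) (Fin L) ℂ from A) c B }
    ‖A‖ (MatL.norm_mul_le A)

@[simp] theorem leftMul_apply {L : ℕ} (A B : MatL L) : leftMul A B = A * B := rfl

/-- A sequence of self-adjoint matrices `V(n)`, `n ∈ ℤ`, with `∑ ‖V(n)‖ < ∞`, where `‖V(n)‖` is
the norm of `V(n)` as a multiplication operator on `M_L`. -/
structure Potential (L : ℕ) where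
  toFun : ℤ → MatL L
  isHermitian : ∀ n, Matrix.IsHermitian (n := Fin L) (α := ℂ) (toFun n)
  summable_norm : Summable fun n => ‖leftMul (toFun n)‖

/-- `‖V‖_ρ = ∑ (1 + |n|)^ρ ‖V(n)‖ < ∞`. -/
def Potential.HasMoment {L : ℕ} (V : Potential L) (ρ : ℝ) : Prop :=
  Summable fun n : ℤ => (1 + |(n : ℝ)|) ^ ρ * ‖leftMul (V.toFun n)‖

theorem EllTwo.summable_sq {L : ℕ} (u : EllTwo L) : Summable fun n => ‖u n‖ ^ 2 := by
  have h := (memℓp_gen_iff (p := 2) (by norm_num)).1 (lp.memℓp u)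
  simpa using h

theorem EllTwo.norm_sq {L : ℕ} (u : EllTwo L) : ‖u‖ ^ 2 = ∑' n, ‖u n‖ ^ 2 := by
  have h := lp.norm_rpow_eq_tsum (p := 2) (by norm_num) u
  simpa using h

theorem EllTwo.memℓp_of_summable {L : ℕ} {u : ℤ → MatL L} (h : Summable fun n => ‖u n‖ ^ 2) :
    Memℓp u 2 := by
  rw [memℓp_gen_iff (p := 2) (by norm_num)]
  simpa using h

theorem EllTwo.summable_shift {L : ℕ} (u : EllTwo L) (k : ℤ) :
    Summable fun n => ‖u (n + k)‖ ^ 2 :=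
  u.summable_sq.comp_injective (i := fun n : ℤ => n + k) (add_left_injective k)

/-- The shift `(S_k u)(n) = u(n + k)` on `ℓ²(ℤ, M_L)`. -/
noncomputable def shiftOp (L : ℕ) (k : ℤ) : EllTwo L →L[ℂ] EllTwo L :=
  LinearMap.mkContinuous
    { toFun := fun u => ⟨fun n => u (n + k), EllTwo.memℓp_of_summable (u.summable_shift k)⟩
      map_add' := fun _ _ => rfl
      map_smul' := fun _ _ => rfl } 1 (by
    intro u
    rw [one_mul]
    refine (sq_le_sq₀ (norm_nonneg _) (norm_nonneg _)).1 ?_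
    rw [EllTwo.norm_sq, EllTwo.norm_sq]
    exact ((Equiv.addRight k).tsum_eq (fun n => ‖u n‖ ^ 2)).le)

theorem Potential.norm_le {L : ℕ} (V : Potential L) (n : ℤ) :
    ‖leftMul (V.toFun n)‖ ≤ ∑' m, ‖leftMul (V.toFun m)‖ :=
  V.summable_norm.le_tsum n fun _ _ => norm_nonneg _

theorem Potential.norm_mul_sq_le {L : ℕ} (V : Potential L) (u : ℤ → MatL L) (n : ℤ) :
    ‖V.toFun n * u n‖ ^ 2 ≤ (∑' m, ‖leftMul (V.toFun m)‖) ^ 2 * ‖u n‖ ^ 2 := by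
  rw [← mul_pow]
  refine pow_le_pow_left₀ (norm_nonneg _) ?_ 2
  exact ((leftMul (V.toFun n)).le_opNorm (u n)).trans
    (mul_le_mul_of_nonneg_right (V.norm_le n) (norm_nonneg _))

/-- The multiplication operator `(V u)(n) = V(n) u(n)` on `ℓ²(ℤ, M_L)`. -/
noncomputable def Potential.mulOp {L : ℕ} (V : Potential L) : EllTwo L →L[ℂ] EllTwo L :=
  LinearMap.mkContinuous
    { toFun := fun u => ⟨fun n => V.toFun n * u n, EllTwo.memℓp_of_summable
        (Summable.of_nonneg_of_le (fun _ => sq_nonneg _) (V.norm_mul_sq_le u)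
          (u.summable_sq.mul_left _))⟩
      map_add' := fun u v => lp.ext (funext fun n => (leftMul (V.toFun n)).map_add (u n) (v n))
      map_smul' := fun c u => lp.ext (funext fun n => (leftMul (V.toFun n)).map_smul c (u n)) }
    (∑' m, ‖leftMul (V.toFun m)‖) (by
    intro u
    have h0 : 0 ≤ ∑' m, ‖leftMul (V.toFun m)‖ := tsum_nonneg fun _ => norm_nonneg _
    refine (sq_le_sq₀ (norm_nonneg _) (mul_nonneg h0 (norm_nonneg _))).1 ?_
    rw [mul_pow, EllTwo.norm_sq, EllTwo.norm_sq, ← tsum_mul_left]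
    exact Summable.tsum_le_tsum (V.norm_mul_sq_le u)
      (Summable.of_nonneg_of_le (fun _ => sq_nonneg _) (V.norm_mul_sq_le u)
          (u.summable_sq.mul_left _)) (u.summable_sq.mul_left _))

/-- The Schrödinger operator `(H u)(n) = u(n + 1) + u(n - 1) + V(n) u(n)` on `ℓ²(ℤ, M_L)`. -/
noncomputable def schrodinger {L : ℕ} (V : Potential L) : EllTwo L →L[ℂ] EllTwo L :=
  shiftOp L 1 + shiftOp L (-1) + V.mulOp

theorem schrodinger_apply {L : ℕ} (V : Potential L) (u : EllTwo L) (n : ℤ) :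
    schrodinger V u n = u (n + 1) + u (n - 1) + V.toFun n * u n := rfl

/-- The point spectrum `σ_p(H)`: the set of eigenvalues of `H` in `ℓ²(ℤ, M_L)`. -/
def pointSpectrum {L : ℕ} (V : Potential L) : Set ℂ :=
  {E | ∃ u : EllTwo L, u ≠ 0 ∧ schrodinger V u = E • u}

/-- The resolvent `R_H(E) = (H - E)⁻¹`, for `E` outside the spectrum of `H`. -/
noncomputable def resolventOp {L : ℕ} (V : Potential L) (E : ℂ) : EllTwo L →L[ℂ] EllTwo L :=
  Ring.inverse (schrodinger V - algebraMap ℂ (EllTwo L →L[ℂ] EllTwo L) E)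

/-- The matrix elements `[T]_{s,r} = π_s T π_r^* ∈ B(M_L)` of a bounded operator `T`, where
`π_s u = u(s)` and `(π_r^* A)(s) = δ_{r,s} A`. -/
noncomputable def matrixElement {L : ℕ} (T : EllTwo L →L[ℂ] EllTwo L) (s r : ℤ) :
    MatL L →L[ℂ] MatL L :=
  (lp.evalCLM ℂ (fun _ : ℤ => MatL L) 2 s).comp
    (T.comp (lp.singleContinuousLinearMap ℂ (fun _ : ℤ => MatL L) 2 r))

/-- The closed half-plane `{E | ± Im E ≥ 0}`; the sign `±` is `σ : ℤˣ`, that is, `1` or `-1`. -/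
def closedHalfPlane (σ : ℤˣ) : Set ℂ := {E | 0 ≤ ((σ : ℤ) : ℝ) * E.im}

/-- The open interval `(-2, 2)` as a subset of `ℂ`. -/
def openBand : Set ℂ := {E | E.im = 0 ∧ |E.re| < 2}

/-- The closed interval `[-2, 2]` as a subset of `ℂ`. -/
def closedBand : Set ℂ := {E | E.im = 0 ∧ |E.re| ≤ 2}

/-- The point `E ± i ε`. -/
noncomputable def offAxis (σ : ℤˣ) (E : ℂ) (ε : ℝ) : ℂ :=
  E + ((σ : ℤ) : ℂ) * (ε : ℂ) * Complex.I

/-- The boundary value `[R_H(E ± i0)]_{s,r} = lim_{ε → 0⁺} [R_H(E ± i ε)]_{s,r}` (meaningful when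
the limit exists). -/
noncomputable def boundaryKernel {L : ℕ} (V : Potential L) (σ : ℤˣ) (E : ℂ) (s r : ℤ) :
    MatL L →L[ℂ] MatL L :=
  limUnder (𝓝[>] (0 : ℝ)) fun ε => matrixElement (resolventOp V (offAxis σ E ε)) s r

open Classical in
/-- The kernel `[R_H^±(E)]_{s,r}`: the boundary value for `E ∈ (-2, 2)`, and the matrix element of
the resolvent otherwise. -/
noncomputable def resolventKernel {L : ℕ} (V : Potential L) (σ : ℤˣ) (E : ℂ) (s r : ℤ) :
    MatL L →L[ℂ] MatL L :=
  if E ∈ openBand then boundaryKernel V σ E s r else matrixElement (resolventOp V E) s r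

/-- The domain of the integral operator with kernel `k`: all sequences `u` such that
`∑_r ‖k_{s,r} u(r)‖ < ∞` for every `s`. -/
def kernelDomain {L : ℕ} (k : ℤ → ℤ → MatL L →L[ℂ] MatL L) : Set (ℤ → MatL L) :=
  {u | ∀ s, Summable fun r => ‖k s r (u r)‖}

/-- The integral operator `(k u)(s) = ∑_r k_{s,r} u(r)` with kernel `k`. -/
noncomputable def kernelApply {L : ℕ} (k : ℤ → ℤ → MatL L →L[ℂ] MatL L) (u : ℤ → MatL L) :
    ℤ → MatL L :=
  fun s => ∑' r, k s r (u r)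

/-- The weight `(T_{-α} u)(n) = (1 + |n|)^{-α} u(n)` on sequences. -/
noncomputable def weight {L : ℕ} (α : ℝ) (u : ℤ → MatL L) : ℤ → MatL L :=
  fun n => (1 + |(n : ℝ)|) ^ (-α) • u n

/-- The bounded operator `B` on `ℓ²(ℤ, M_L)` is `T_{-α} R_H^±(E) T_{-α}`: for every
`u ∈ ℓ²(ℤ, M_L)`, the sequence `T_{-α} u` lies in the domain of `R_H^±(E)`, and
`B u = T_{-α} R_H^±(E) T_{-α} u`. -/
def IsWeightedResolvent {L : ℕ} (V : Potential L) (σ : ℤˣ) (α : ℝ) (E : ℂ)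
    (B : EllTwo L →L[ℂ] EllTwo L) : Prop :=
  ∀ u : EllTwo L,
    weight α u ∈ kernelDomain (resolventKernel V σ E) ∧
    (B u : ℤ → MatL L) = weight α (kernelApply (resolventKernel V σ E) (weight α u))

/-- The Zhukovsky map `J(z) = z + 1 / z`. -/
noncomputable def zhukovsky (z : ℂ) : ℂ := z + 1 / z

open Classical in
/-- The functions `r_±`: outside `[-2, 2]` the inverse of `J` restricted to `{0 < |z| < 1}`, and
`r_±(2 cos k) = e^{∓ i k}` for `k ∈ [0, π]`. -/
noncomputable def zhukovskyInv (σ : ℤˣ) (E : ℂ) : ℂ :=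
  if E ∈ closedBand then
    Complex.exp (-(((σ : ℤ) : ℂ) * Complex.I * (Real.arccos (E.re / 2) : ℂ)))
  else
    Function.invFunOn zhukovsky {z : ℂ | z ≠ 0 ∧ ‖z‖ < 1} E

/-! ### Operators on sequence spaces given by kernels -/

section SequenceOperators

/-! Write `E = z + 1/z` with `z = r_±(E)` in the closed unit disc. The free resolvent `G` is
convolution with `green z`, whose entries are bounded by `1/|z² - 1|` up to the unit circle, so `G`
makes sense on the band as well. The resolvent of `H` is `G (1 + V G)⁻¹`; sandwiched between weights
it is `weightedResolvent`, defined uniformly for `|z| < 1` and `|z| = 1`. With `θ = min ρ 1`, the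
inverse is taken on the sequences `f` with `∑ (1 + |n|)^θ ‖f(n)‖ < ∞`; `T_{-α}` maps `ℓ²` into this
space because `α - θ > 1/2`.

Invertibility: `V G` is compact there, so by the Fredholm alternative it suffices to exclude `f = -V
G f` with `f ≠ 0`. Put `u = G f`, a solution of the Schrödinger equation. If `|z| < 1`, then `u ∈
ℓ²` and `E` would be an eigenvalue. If `|z| = 1`, the Wronskian `Im ⟨u(n), u(n+1)⟩` is constant,
while its limits at the two ends are `Im z` times the squared outgoing amplitudes, with opposite
signs. Both amplitudes vanish (`tsum_zpow_smul_eq_zero`), so `u(s)` is controlled by the tail of `V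
u` beyond `s`; a contraction gives `u = 0` near `+∞`, hence everywhere
(`eq_zero_of_eq_neg_green_convolution`).

Hölder bound: interpolating between boundedness and a Lipschitz bound, `green` changes by `O((1 + |s
- r|)^θ |z - w|^θ)`, and `1 + |s - r| ≤ (1 + |s|)(1 + |r|)` passes the growth to the weights. Only
`θ` moments of `V` are available, so `V G` itself is shown to be merely norm continuous, which
bounds `(1 + V G)⁻¹` uniformly on compact sets; the rate comes from `resolvent_sub_eq`, where the
difference of the potential terms is weighted on both sides. Finally `r_±` is Lipschitz on `K`
(`norm_zhukovskyInv_sub_le`), which also yields the boundary values as norm limits. -/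

theorem lp.summable_norm_one {F : Type*} [NormedAddCommGroup F] (x : lp (fun _ : ℤ => F) 1) :
    Summable fun n => ‖x n‖ := by
  simpa using (lp.memℓp x).summable (by norm_num)

theorem lp.norm_one_eq_tsum {F : Type*} [NormedAddCommGroup F] (x : lp (fun _ : ℤ => F) 1) :
    ‖x‖ = ∑' n, ‖x n‖ := by
  simpa using lp.norm_eq_tsum_rpow (p := 1) (by norm_num) x

theorem memℓp_one_of_summable {G : Type*} [NormedAddCommGroup G] {u : ℤ → G}
    (h : Summable fun n => ‖u n‖) : Memℓp u 1 := by
  rw [memℓp_gen_iff (p := 1) (by norm_num)]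
  simpa using h

variable {F : Type*} [NormedAddCommGroup F] [NormedSpace ℂ F]

theorem lp.hasSum_clm_single {G : Type*} [NormedAddCommGroup G] [NormedSpace ℂ G]
    {p : ENNReal} [Fact (1 ≤ p)] (hp : p ≠ ⊤)
    (T : lp (fun _ : ℤ => F) p →L[ℂ] G) (x : lp (fun _ : ℤ => F) p) :
    HasSum (fun r => T (lp.single p r (x r))) (T x) :=
  T.hasSum (lp.hasSum_single hp x)

/-- On `ℓ¹` the norm of an operator is the supremum over its columns. This is why the analysis runs
through `ℓ¹`: entrywise bounds on kernels suffice. -/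
theorem lp.norm_apply_le_of_single {G : Type*} [NormedAddCommGroup G] [NormedSpace ℂ G]
    (T : lp (fun _ : ℤ => F) 1 →L[ℂ] G) {c : ℝ}
    (h : ∀ r a, ‖T (lp.single 1 r a)‖ ≤ c * ‖a‖) (x : lp (fun _ : ℤ => F) 1) :
    ‖T x‖ ≤ c * ‖x‖ := by
  refine (lp.hasSum_clm_single (by norm_num) T x).norm_le_of_bounded ?_ fun r => h r (x r)
  rw [lp.norm_one_eq_tsum]
  exact (lp.summable_norm_one x).hasSum.mul_left c

theorem lp.norm_le_of_bound {F : Type*} [NormedAddCommGroup F] {p : ENNReal} [Fact (1 ≤ p)]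
    (y : lp (fun _ : ℤ => F) p) (b : lp (fun _ : ℤ => ℝ) p) {c : ℝ} (hc : 0 ≤ c)
    (h : ∀ s, ‖y s‖ ≤ c * ‖b s‖) : ‖y‖ ≤ c * ‖b‖ := by
  have h1 : ‖y‖ ≤ ‖c • b‖ :=
    lp.norm_mono (zero_lt_one.trans_le (Fact.out : 1 ≤ p)).ne' fun s => by
      rw [lp.coeFn_smul, Pi.smul_apply, norm_smul, Real.norm_of_nonneg hc]
      exact h s
  rwa [norm_smul, Real.norm_of_nonneg hc] at h1

/-- An operator from `ℓ¹` to `ℓᵖ` whose matrix elements `(s, r)` are bounded by `c ‖b s‖` has norm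
at most `c ‖b‖`. -/
theorem lp.opNorm_le_of_single {p : ENNReal} [Fact (1 ≤ p)]
    (T : lp (fun _ : ℤ => F) 1 →L[ℂ] lp (fun _ : ℤ => F) p) (b : lp (fun _ : ℤ => ℝ) p) {c : ℝ}
    (hc : 0 ≤ c) (h : ∀ r a s, ‖T (lp.single 1 r a) s‖ ≤ c * ‖b s‖ * ‖a‖) : ‖T‖ ≤ c * ‖b‖ := by
  refine T.opNorm_le_bound (by positivity) fun x => ?_
  have hx : ∀ s, ‖T x s‖ ≤ c * ‖b s‖ * ‖x‖ := fun s =>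
    lp.norm_apply_le_of_single ((lp.evalCLM ℂ (fun _ : ℤ => F) p s).comp T) (fun r a => h r a s) x
  refine (lp.norm_le_of_bound (T x) b (c := c * ‖x‖) (by positivity) fun s => ?_).trans_eq
    (by ring)
  exact (hx s).trans_eq (by ring)

theorem memℓp_diag {p : ENNReal} {c : ℤ → ℂ} (hc : ∀ n, ‖c n‖ ≤ 1) (x : lp (fun _ : ℤ => F) p) :
    Memℓp (fun n => c n • x n) p :=
  Memℓp.mono (g := fun n => ‖x n‖) (lp.memℓp x).norm fun n => by
    change ‖c n • x n‖ ≤ ‖x n‖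
    rw [norm_smul]
    exact mul_le_of_le_one_left (norm_nonneg _) (hc n)

/-- Multiplication of sequences by a sequence of numbers of modulus at most `1`. -/
noncomputable def diagOp (p : ENNReal) [Fact (1 ≤ p)] (c : ℤ → ℂ) (hc : ∀ n, ‖c n‖ ≤ 1) :
    lp (fun _ : ℤ => F) p →L[ℂ] lp (fun _ : ℤ => F) p :=
  LinearMap.mkContinuous
    { toFun := fun x => ⟨fun n => c n • x n, memℓp_diag hc x⟩
      map_add' := fun x y => lp.ext (funext fun n => smul_add (c n) (x n) (y n))
      map_smul' := fun d x => lp.ext (funext fun n => smul_comm (c n) d (x n)) } 1 (by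
    intro x
    rw [one_mul]
    refine lp.norm_mono (zero_lt_one.trans_le (Fact.out : 1 ≤ p)).ne' fun n => ?_
    change ‖c n • x n‖ ≤ _
    rw [norm_smul]
    exact mul_le_of_le_one_left (norm_nonneg _) (hc n))

theorem diagOp_apply {p : ENNReal} [Fact (1 ≤ p)] {c : ℤ → ℂ} (hc : ∀ n, ‖c n‖ ≤ 1)
    (x : lp (fun _ : ℤ => F) p) (n : ℤ) : diagOp p c hc x n = c n • x n := rfl

theorem diagOp_single {p : ENNReal} [Fact (1 ≤ p)] {c : ℤ → ℂ} (hc : ∀ n, ‖c n‖ ≤ 1)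
    (r : ℤ) (a : F) : diagOp p c hc (lp.single p r a) = lp.single p r (c r • a) := by
  refine lp.ext (funext fun n => ?_)
  rw [diagOp_apply]
  by_cases h : n = r
  · subst h; simp
  · rw [lp.single_apply_ne _ _ _ h, lp.single_apply_ne _ _ _ h, smul_zero]

theorem two_toReal_holderConjugate :
    (2 : ENNReal).toReal.HolderConjugate (2 : ENNReal).toReal := by
  simpa using Real.HolderConjugate.two_two

theorem summable_norm_mul {F : Type*} [NormedAddCommGroup F]
    (c : lp (fun _ : ℤ => ℂ) 2) (x : lp (fun _ : ℤ => F) 2) :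
    Summable fun n => ‖c n‖ * ‖x n‖ := by
  simpa using lp.summable_mul two_toReal_holderConjugate (lp.toNorm c) (lp.toNorm x)

theorem tsum_norm_mul_le {F : Type*} [NormedAddCommGroup F]
    (c : lp (fun _ : ℤ => ℂ) 2) (x : lp (fun _ : ℤ => F) 2) :
    ∑' n, ‖c n‖ * ‖x n‖ ≤ ‖c‖ * ‖x‖ := by
  simpa [lp.norm_toNorm] using
    lp.tsum_mul_le_mul_norm' two_toReal_holderConjugate (lp.toNorm c) (lp.toNorm x)

/-- Multiplication by a square summable sequence, as an operator from `ℓ²` to `ℓ¹`. -/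
noncomputable def diagTwoOne (c : lp (fun _ : ℤ => ℂ) 2) :
    lp (fun _ : ℤ => F) 2 →L[ℂ] lp (fun _ : ℤ => F) 1 :=
  LinearMap.mkContinuous
    { toFun := fun x => ⟨fun n => c n • x n, memℓp_one_of_summable (by
        simpa [norm_smul] using summable_norm_mul c x)⟩
      map_add' := fun x y => lp.ext (funext fun n => smul_add (c n) (x n) (y n))
      map_smul' := fun d x => lp.ext (funext fun n => smul_comm (c n) d (x n)) } ‖c‖ (by
    intro x
    rw [lp.norm_one_eq_tsum]
    refine le_trans (le_of_eq ?_) (tsum_norm_mul_le c x)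
    exact tsum_congr fun n => norm_smul (c n) (x n))

variable [CompleteSpace F]

theorem summable_kernel {k : ℤ → F →L[ℂ] F} {c : ℝ} (h : ∀ r, ‖k r‖ ≤ c)
    (x : lp (fun _ : ℤ => F) 1) : Summable fun r => k r (x r) :=
  .of_norm_bounded ((lp.summable_norm_one x).mul_left c) fun r => (k r).le_of_opNorm_le (h r) _

theorem norm_tsum_kernel_le {k : ℤ → F →L[ℂ] F} {c : ℝ} (h : ∀ r, ‖k r‖ ≤ c)
    (x : lp (fun _ : ℤ => F) 1) : ‖∑' r, k r (x r)‖ ≤ c * ‖x‖ := by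
  refine (summable_kernel h x).hasSum.norm_le_of_bounded ?_
    fun r => (k r).le_of_opNorm_le (h r) _
  rw [lp.norm_one_eq_tsum]
  exact (lp.summable_norm_one x).hasSum.mul_left c

/-- The kernel `k` has a majorant in `ℓᵖ` depending on the row only. -/
def HasRowBound (p : ENNReal) (k : ℤ → ℤ → F →L[ℂ] F) : Prop :=
  ∃ b : ℤ → ℝ, Memℓp b p ∧ ∀ s r, ‖k s r‖ ≤ b s

theorem memℓp_kernel {p : ENNReal} {k : ℤ → ℤ → F →L[ℂ] F} {b : ℤ → ℝ} (hb : Memℓp b p)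
    (h : ∀ s r, ‖k s r‖ ≤ b s) (x : lp (fun _ : ℤ => F) 1) :
    Memℓp (fun s => ∑' r, k s r (x r)) p :=
  Memℓp.mono (hb.const_smul ‖x‖) fun s =>
    (norm_tsum_kernel_le (h s) x).trans_eq (mul_comm _ _)

open Classical in
/-- The operator `(k x)(s) = ∑_r k(s, r) x(r)` from `ℓ¹` to `ℓᵖ`, for a kernel with a row bound;
`0` for other kernels. -/
noncomputable def kernelOp (p : ENNReal) [Fact (1 ≤ p)] (k : ℤ → ℤ → F →L[ℂ] F) :
    lp (fun _ : ℤ => F) 1 →L[ℂ] lp (fun _ : ℤ => F) p :=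
  if h : HasRowBound p k then
    LinearMap.mkContinuous
      { toFun := fun x => ⟨fun s => ∑' r, k s r (x r),
          memℓp_kernel h.choose_spec.1 h.choose_spec.2 x⟩
        map_add' := fun x y => lp.ext (funext fun s => by
          change ∑' r, k s r (x r + y r) = ∑' r, k s r (x r) + ∑' r, k s r (y r)
          rw [← (summable_kernel (h.choose_spec.2 s) x).tsum_add
            (summable_kernel (h.choose_spec.2 s) y)]
          exact tsum_congr fun r => map_add _ _ _)
        map_smul' := fun c x => lp.ext (funext fun s => by
          change ∑' r, k s r (c • x r) = c • ∑' r, k s r (x r)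
          rw [← (summable_kernel (h.choose_spec.2 s) x).tsum_const_smul c]
          exact tsum_congr fun r => map_smul _ _ _) }
      ‖(⟨h.choose, h.choose_spec.1⟩ : lp (fun _ : ℤ => ℝ) p)‖ (fun x => by
        rw [mul_comm]
        refine lp.norm_le_of_bound _ _ (norm_nonneg x) fun s => ?_
        refine (norm_tsum_kernel_le (h.choose_spec.2 s) x).trans ?_
        rw [mul_comm]
        exact mul_le_mul_of_nonneg_left (le_abs_self _) (norm_nonneg x))
  else 0

theorem kernelOp_apply {p : ENNReal} [Fact (1 ≤ p)] {k : ℤ → ℤ → F →L[ℂ] F}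
    (h : HasRowBound p k) (x : lp (fun _ : ℤ => F) 1) (s : ℤ) :
    kernelOp p k x s = ∑' r, k s r (x r) := by
  rw [kernelOp, dif_pos h]
  rfl

theorem kernelOp_single {p : ENNReal} [Fact (1 ≤ p)] {k : ℤ → ℤ → F →L[ℂ] F}
    (h : HasRowBound p k) (r : ℤ) (a : F) (s : ℤ) :
    kernelOp p k (lp.single 1 r a) s = k s r a := by
  rw [kernelOp_apply h, tsum_eq_single r, lp.single_apply_self]
  intro r' hr'
  rw [lp.single_apply_ne _ _ _ hr', map_zero]

/-- An operator on `ℓ¹` whose matrix elements have a summable row bound is compact. -/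
theorem isCompactOperator_of_single [FiniteDimensional ℂ F]
    (T : lp (fun _ : ℤ => F) 1 →L[ℂ] lp (fun _ : ℤ => F) 1) {b : ℤ → ℝ} (hb : Summable b)
    (h : ∀ r a s, ‖T (lp.single 1 r a) s‖ ≤ b s * ‖a‖) : IsCompactOperator T := by
  let row : ℤ → lp (fun _ : ℤ => F) 1 →L[ℂ] F := fun s =>
    (lp.evalCLM ℂ (fun _ : ℤ => F) 1 s).comp T
  -- `R s` keeps only row `s`, so its range is finite-dimensional; the row bounds are summable, so
  -- `T = ∑ R s` in norm.
  let R : ℤ → lp (fun _ : ℤ => F) 1 →L[ℂ] lp (fun _ : ℤ => F) 1 := fun s =>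
    (lp.singleContinuousLinearMap ℂ (fun _ : ℤ => F) 1 s).comp (row s)
  have hR : ∀ s, ‖R s‖ ≤ |b s| := fun s =>
    (R s).opNorm_le_bound (abs_nonneg _) fun x => by
      have h1 : R s x = lp.single (E := fun _ : ℤ => F) 1 s (T x s) := rfl
      rw [h1, lp.norm_single (by norm_num)]
      refine lp.norm_apply_le_of_single (G := F) (row s) (c := |b s|) (fun r a => ?_) x
      exact (h r a s).trans (mul_le_mul_of_nonneg_right (le_abs_self _) (norm_nonneg _))
  have hs : Summable R := .of_norm_bounded hb.abs hR
  have hT : ∑' s, R s = T := by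
    refine ContinuousLinearMap.ext fun x => ?_
    have h1 := (ContinuousLinearMap.apply ℂ (lp (fun _ : ℤ => F) 1) x).hasSum hs.hasSum
    exact h1.unique (lp.hasSum_single (by norm_num) (T x))
  have : ProperSpace F := FiniteDimensional.proper_rclike ℂ F
  rw [← hT]
  refine isCompactOperator_of_tendsto hs.hasSum (.of_forall fun S => ?_)
  induction S using Finset.cons_induction with
  | empty => simpa using isCompactOperator_zero
  | cons s S hs ih =>
    rw [Finset.sum_cons]
    refine IsCompactOperator.add (f := R s) ?_ ih
    exact (isCompactOperator_of_locallyCompactSpace_rng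
      (lp.singleContinuousLinearMap ℂ (fun _ : ℤ => F) 1 s)).comp_clm (row s)

end SequenceOperators

/-! ### The free Green kernel and its dependence on `z` -/

section Green

/-- The kernel `z^|n| / (z - 1/z)` of the resolvent of the free operator at `z + 1/z`. -/
noncomputable def green (z : ℂ) (n : ℤ) : ℂ := z ^ (n.natAbs + 1) / (z ^ 2 - 1)

theorem green_neg (z : ℂ) (n : ℤ) : green z (-n) = green z n := by
  rw [green, green, Int.natAbs_neg]

theorem green_recurrence {z : ℂ} (h0 : z ≠ 0) (h1 : z ^ 2 ≠ 1) (n : ℤ) :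
    green z (n + 1) + green z (n - 1) - (z + 1 / z) * green z n = if n = 0 then 1 else 0 := by
  have h2 : z ^ 2 - 1 ≠ 0 := sub_ne_zero.2 h1
  have pos : ∀ m : ℕ, green z ((m : ℤ) + 1 + 1) + green z ((m : ℤ) + 1 - 1)
      - (z + 1 / z) * green z ((m : ℤ) + 1) = 0 := by
    intro m
    have e1 : ((m : ℤ) + 1 + 1).natAbs = m + 2 := by omega
    have e2 : ((m : ℤ) + 1 - 1).natAbs = m := by omega
    have e3 : ((m : ℤ) + 1).natAbs = m + 1 := by omega
    rw [green, green, green, e1, e2, e3]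
    field_simp
    ring
  rcases lt_trichotomy n 0 with h | h | h
  · obtain ⟨m, rfl⟩ : ∃ m : ℕ, n = -((m : ℤ) + 1) := ⟨(-n - 1).toNat, by omega⟩
    rw [if_neg (by omega), ← pos m, ← green_neg z (-((m : ℤ) + 1) + 1),
      ← green_neg z (-((m : ℤ) + 1) - 1), green_neg z ((m : ℤ) + 1)]
    ring_nf
  · subst h
    rw [if_pos rfl, green, green, green]
    norm_num
    field_simp
    ring
  · obtain ⟨m, rfl⟩ : ∃ m : ℕ, n = (m : ℤ) + 1 := ⟨(n - 1).toNat, by omega⟩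
    rw [if_neg (by omega), pos m]

/-- The bound is uniform in `n` and degenerates only at `z = ±1`, the band edges; nothing is lost on
the unit circle. -/
theorem norm_green_le {z : ℂ} (hz : ‖z‖ ≤ 1) (n : ℤ) : ‖green z n‖ ≤ ‖z ^ 2 - 1‖⁻¹ := by
  rw [green, norm_div, norm_pow, div_eq_mul_inv]
  exact mul_le_of_le_one_left (by positivity) (pow_le_one₀ (norm_nonneg z) hz)

theorem norm_pow_sub_pow_le {z w : ℂ} (hz : ‖z‖ ≤ 1) (hw : ‖w‖ ≤ 1) (m : ℕ) :
    ‖z ^ m - w ^ m‖ ≤ m * ‖z - w‖ := by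
  induction m with
  | zero => simp
  | succ m ih =>
    have e : z ^ (m + 1) - w ^ (m + 1) = z * (z ^ m - w ^ m) + (z - w) * w ^ m := by ring
    rw [e]
    refine (norm_add_le _ _).trans ?_
    rw [norm_mul, norm_mul, norm_pow]
    have h1 : ‖z‖ * ‖z ^ m - w ^ m‖ ≤ 1 * (m * ‖z - w‖) := by gcongr
    have h2 : ‖z - w‖ * ‖w‖ ^ m ≤ ‖z - w‖ * 1 := by
      gcongr
      exact pow_le_one₀ (norm_nonneg w) hw
    push_cast
    linarith

/-- Interpolation: with `x = (1 + |n|) ‖z - w‖`, the difference is bounded both by a constant and by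
that constant times `x`, and `min 1 x ≤ x ^ θ` for `0 ≤ θ ≤ 1`. -/
theorem norm_green_sub_le {z w : ℂ} {δ θ : ℝ} (hδ : 0 < δ) (hθ : 0 ≤ θ) (hθ1 : θ ≤ 1)
    (hz : ‖z‖ ≤ 1) (hw : ‖w‖ ≤ 1) (hzδ : δ ≤ ‖z ^ 2 - 1‖) (hwδ : δ ≤ ‖w ^ 2 - 1‖) (n : ℤ) :
    ‖green z n - green w n‖ ≤
      (2 / δ + 2 / δ ^ 2) * ((1 + |(n : ℝ)|) ^ θ * ‖z - w‖ ^ θ) := by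
  have hz0 : z ^ 2 - 1 ≠ 0 := norm_pos_iff.1 (hδ.trans_le hzδ)
  have hw0 : w ^ 2 - 1 ≠ 0 := norm_pos_iff.1 (hδ.trans_le hwδ)
  have hn : ((n.natAbs + 1 : ℕ) : ℝ) = 1 + |(n : ℝ)| := by
    push_cast
    rw [Nat.cast_natAbs, Int.cast_abs, add_comm]
  have hD : (0 : ℝ) ≤ 2 / δ ^ 2 := by positivity
  have hD' : (0 : ℝ) ≤ 2 / δ := by positivity
  have hiz : ‖z ^ 2 - 1‖⁻¹ ≤ δ⁻¹ := inv_anti₀ hδ hzδ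
  have hiw : ‖w ^ 2 - 1‖⁻¹ ≤ δ⁻¹ := inv_anti₀ hδ hwδ
  have hA : ‖green z n - green w n‖ ≤ 2 / δ + 2 / δ ^ 2 := by
    refine (norm_sub_le _ _).trans ?_
    have h1 := (norm_green_le hz n).trans hiz
    have h2 := (norm_green_le hw n).trans hiw
    have h3 : 2 / δ = δ⁻¹ + δ⁻¹ := by ring
    linarith
  set x : ℝ := (1 + |(n : ℝ)|) * ‖z - w‖ with hx
  have hx0 : 0 ≤ x := by positivity
  have hB : ‖green z n - green w n‖ ≤ (2 / δ + 2 / δ ^ 2) * x := by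
    -- Separates the change of the numerator from that of the denominator, the latter through `w² -
    -- z² = (w - z)(w + z)`.
    have e : green z n - green w n = (z ^ (n.natAbs + 1) - w ^ (n.natAbs + 1)) / (z ^ 2 - 1)
        + w ^ (n.natAbs + 1) * ((w - z) * (w + z)) / ((z ^ 2 - 1) * (w ^ 2 - 1)) := by
      rw [green, green]
      field_simp
      ring
    rw [e]
    refine (norm_add_le _ _).trans ?_
    have h1 : ‖(z ^ (n.natAbs + 1) - w ^ (n.natAbs + 1)) / (z ^ 2 - 1)‖ ≤ x * δ⁻¹ := by
      rw [norm_div, div_eq_mul_inv, hx, ← hn]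
      gcongr
      exact norm_pow_sub_pow_le hz hw _
    have h2 : ‖w ^ (n.natAbs + 1) * ((w - z) * (w + z)) / ((z ^ 2 - 1) * (w ^ 2 - 1))‖
        ≤ 1 * (‖z - w‖ * 2) * (δ⁻¹ * δ⁻¹) := by
      rw [norm_div, div_eq_mul_inv, norm_mul, norm_mul, norm_mul, norm_pow, norm_sub_rev w z,
        mul_inv]
      gcongr
      · exact pow_le_one₀ (norm_nonneg w) hw
      · exact (norm_add_le _ _).trans (by linarith)
    have h3 : ‖z - w‖ ≤ x := le_mul_of_one_le_left (norm_nonneg _)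
      (by linarith [abs_nonneg (n : ℝ)])
    have h4 : ‖z - w‖ * (2 / δ ^ 2) ≤ x * (2 / δ ^ 2) := by gcongr
    have h5 : 1 * (‖z - w‖ * 2) * (δ⁻¹ * δ⁻¹) = ‖z - w‖ * (2 / δ ^ 2) := by
      field_simp
    have h6 : x * δ⁻¹ ≤ x * (2 / δ) := by
      gcongr
      rw [inv_eq_one_div]
      gcongr
      norm_num
    linarith
  have e : (1 + |(n : ℝ)|) ^ θ * ‖z - w‖ ^ θ = x ^ θ :=
    (Real.mul_rpow (by positivity) (norm_nonneg _)).symm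
  rw [e]
  rcases le_total x 1 with h | h
  · refine hB.trans ?_
    gcongr
    exact Real.self_le_rpow_of_le_one hx0 h hθ1
  · exact hA.trans (le_mul_of_one_le_right (by positivity) (Real.one_le_rpow h hθ))

variable {F : Type*} [NormedAddCommGroup F] [NormedSpace ℂ F]

theorem green_convolution_equation {z : ℂ} (h0 : z ≠ 0) (h1 : z ^ 2 ≠ 1) {f : ℤ → F}
    (hf : ∀ s, Summable fun r => green z (s - r) • f r) (s : ℤ) :
    ∑' r, green z (s + 1 - r) • f r + ∑' r, green z (s - 1 - r) • f r
      = (z + 1 / z) • ∑' r, green z (s - r) • f r + f s := by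
  rw [← sub_eq_iff_eq_add', ← (hf (s + 1)).tsum_add (hf (s - 1)), ← (hf s).tsum_const_smul,
    ← ((hf (s + 1)).add (hf (s - 1))).tsum_sub ((hf s).const_smul _)]
  have : ∀ r, green z (s + 1 - r) • f r + green z (s - 1 - r) • f r
      - (z + 1 / z) • green z (s - r) • f r = if r = s then f s else 0 := by
    intro r
    have e := green_recurrence h0 h1 (s - r)
    rw [smul_smul, ← add_smul, ← sub_smul, show s + 1 - r = s - r + 1 by ring,
      show s - 1 - r = s - r - 1 by ring, e]
    by_cases h : r = s
    · subst h; simp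
    · rw [if_neg h, if_neg (by omega), zero_smul]
  rw [tsum_congr this, tsum_ite_eq]

theorem summable_norm_green {z : ℂ} (hz : ‖z‖ < 1) : Summable fun n => ‖green z n‖ := by
  have h : Summable fun n : ℤ => ‖z‖ ^ n.natAbs := by
    refine Summable.of_nat_of_neg ?_ ?_ <;>
    simpa using summable_geometric_of_lt_one (norm_nonneg z) hz
  refine (h.mul_left (‖z‖ / ‖z ^ 2 - 1‖)).congr fun n => ?_
  rw [green, norm_div, norm_pow]
  ring

end Green

/-! ### Wronskian identity and absence of non-real eigenvalues -/

section Wronskian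

variable {F : Type*} [NormedAddCommGroup F] [InnerProductSpace ℂ F]

/-- The Green identity for solutions of the Schrödinger equation with a symmetric potential. -/
theorem wronskian_sub {V : ℤ → F →L[ℂ] F}
    (hV : ∀ n a b, inner ℂ (V n a) b = inner ℂ a (V n b)) {u : ℤ → F} {E : ℂ}
    (hu : ∀ n, u (n + 1) + u (n - 1) + V n (u n) = E • u n) (n : ℤ) :
    (inner ℂ (u n) (u (n + 1))).im - (inner ℂ (u (n - 1)) (u n)).im = E.im * ‖u n‖ ^ 2 := by
  have h := congrArg (fun x => (inner ℂ (u n) x).im) (hu n)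
  have h1 : (inner ℂ (u n) (V n (u n))).im = 0 := by
    have e := inner_conj_symm (𝕜 := ℂ) (u n) (V n (u n))
    rw [hV] at e
    exact Complex.conj_eq_iff_im.1 e
  have h2 : (inner ℂ (u n) (u (n - 1))).im = -(inner ℂ (u (n - 1)) (u n)).im := by
    rw [← inner_conj_symm, Complex.conj_im]
  have h3 : (inner ℂ (u n) (E • u n)).im = E.im * ‖u n‖ ^ 2 := by
    rw [inner_smul_right, inner_self_eq_norm_sq_to_K]
    norm_cast
    exact Complex.im_mul_ofReal _ _
  simp only [inner_add_right, Complex.add_im] at h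
  rw [h1, h2, h3] at h
  linarith

theorem tendsto_wronskian_of_summable_sq {u : ℤ → F} (hs : Summable fun n => ‖u n‖ ^ 2)
    {l : Filter ℤ} (hl : l ≤ cofinite) :
    Tendsto (fun n => (inner ℂ (u n) (u (n + 1))).im) l (𝓝 0) := by
  have hs1 : Summable fun n => ‖u (n + 1)‖ ^ 2 :=
    hs.comp_injective (i := fun n : ℤ => n + 1) (add_left_injective 1)
  have h0 : Tendsto (fun n => ‖u n‖ ^ 2 + ‖u (n + 1)‖ ^ 2) l (𝓝 0) :=
    (hs.add hs1).tendsto_cofinite_zero.mono_left hl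
  refine squeeze_zero_norm (fun n => ?_) h0
  have h1 : |(inner ℂ (u n) (u (n + 1))).im| ≤ ‖u n‖ * ‖u (n + 1)‖ :=
    (Complex.abs_im_le_norm _).trans (norm_inner_le_norm _ _)
  rw [Real.norm_eq_abs]
  nlinarith [sq_nonneg (‖u n‖ - ‖u (n + 1)‖), sq_nonneg (‖u n‖), sq_nonneg (‖u (n + 1)‖)]

/-- A Schrödinger operator with a symmetric potential has no eigenvalues off the real line. -/
theorem eq_zero_of_summable_sq {V : ℤ → F →L[ℂ] F}
    (hV : ∀ n a b, inner ℂ (V n a) b = inner ℂ a (V n b)) {u : ℤ → F} {E : ℂ}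
    (hu : ∀ n, u (n + 1) + u (n - 1) + V n (u n) = E • u n) (hE : E.im ≠ 0)
    (hs : Summable fun n => ‖u n‖ ^ 2) (n : ℤ) : u n = 0 := by
  set w : ℤ → ℝ := fun n => (inner ℂ (u n) (u (n + 1))).im with hw
  have step : ∀ n, w n - w (n - 1) = E.im * ‖u n‖ ^ 2 := fun n => by
    have := wronskian_sub hV hu n
    simpa [hw] using this
  have top : Tendsto w atTop (𝓝 0) := tendsto_wronskian_of_summable_sq hs (by
    rw [Int.cofinite_eq]; exact le_sup_right)
  have bot : Tendsto w atBot (𝓝 0) := tendsto_wronskian_of_summable_sq hs (by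
    rw [Int.cofinite_eq]; exact le_sup_left)
  -- The Wronskian is monotone, in the direction given by the sign of `Im E`, and tends to `0` at
  -- both ends.
  have hw0 : ∀ m, w m = 0 := by
    intro m
    rcases lt_or_gt_of_ne hE with h | h
    · have anti : Antitone w := antitone_int_of_succ_le fun k => by
        have := step (k + 1)
        rw [add_sub_cancel_right] at this
        nlinarith [sq_nonneg ‖u (k + 1)‖]
      exact le_antisymm (anti.ge_of_tendsto bot m) (anti.le_of_tendsto top m)
    · have mono : Monotone w := monotone_int_of_le_succ fun k => by
        have := step (k + 1)
        rw [add_sub_cancel_right] at this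
        nlinarith [sq_nonneg ‖u (k + 1)‖]
      exact le_antisymm (mono.ge_of_tendsto top m) (mono.le_of_tendsto bot m)
  have h := step n
  rw [hw0, hw0, sub_zero] at h
  simpa [hE] using h.symm

end Wronskian

/-! ### Absence of resonances inside the band -/

section Resonance

variable {F : Type*} [NormedAddCommGroup F] [InnerProductSpace ℂ F]

theorem green_eq_of_nonneg (z : ℂ) {n : ℤ} (hn : 0 ≤ n) :
    green z n = z / (z ^ 2 - 1) * z ^ n := by
  obtain ⟨m, rfl⟩ := Int.eq_ofNat_of_zero_le hn
  rw [green, zpow_natCast, Int.natAbs_natCast, pow_succ]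
  ring

/-- To the right of `r` the kernel is exactly a plane wave in `s`, so each term is eventually
constant and dominated convergence applies. -/
theorem tendsto_green_convolution_atTop [CompleteSpace F] {z : ℂ} (hz : ‖z‖ = 1) {f : ℤ → F}
    (hf : Summable fun r => ‖f r‖) :
    Tendsto (fun s : ℤ => z ^ (-s) • ∑' r, green z (s - r) • f r) atTop
      (𝓝 ((z / (z ^ 2 - 1)) • ∑' r, z ^ (-r) • f r)) := by
  have hz0 : z ≠ 0 := norm_pos_iff.1 (by rw [hz]; exact one_pos)
  simp_rw [← tsum_const_smul'' (_ : ℂ)]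
  refine tendsto_tsum_of_dominated_convergence (hf.mul_left ‖z ^ 2 - 1‖⁻¹) (fun r => ?_)
    (.of_forall fun s r => ?_)
  · refine tendsto_const_nhds.congr' ?_
    filter_upwards [eventually_ge_atTop r] with s hs
    rw [green_eq_of_nonneg z (sub_nonneg.2 hs), smul_smul, smul_smul, sub_eq_add_neg s r, zpow_add₀ hz0,
      zpow_neg z s]
    have := zpow_ne_zero s hz0
    congr 1
    field_simp
  · rw [norm_smul, norm_smul, norm_zpow, hz, one_zpow, one_mul]
    gcongr
    exact norm_green_le hz.le _

/-- The wave `z ^ s • a` carries the flux `Im z ‖a‖²`, and the Wronskian sees only the asymptotics.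
-/
theorem tendsto_wronskian_of_tendsto {z : ℂ} (hz : ‖z‖ = 1) {u : ℤ → F} {a : F}
    (h : Tendsto (fun s : ℤ => z ^ (-s) • u s) atTop (𝓝 a)) :
    Tendsto (fun s : ℤ => (inner ℂ (u s) (u (s + 1))).im) atTop (𝓝 (z.im * ‖a‖ ^ 2)) := by
  have hz0 : z ≠ 0 := norm_pos_iff.1 (by rw [hz]; exact one_pos)
  have h1 : Tendsto (fun s : ℤ => z ^ (-(s + 1)) • u (s + 1)) atTop (𝓝 a) :=
    h.comp (tendsto_atTop_add_const_right _ 1 tendsto_id)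
  have h2 := Complex.continuous_im.continuousAt.tendsto.comp ((h.inner (𝕜 := ℂ) h1).const_mul z)
  have h3 : (z * inner ℂ a a).im = z.im * ‖a‖ ^ 2 := by
    rw [inner_self_eq_norm_sq_to_K]
    norm_cast
    exact Complex.im_mul_ofReal _ _
  rw [h3] at h2
  refine h2.congr fun s => ?_
  simp only [Function.comp_apply]
  rw [inner_smul_left, inner_smul_right]
  have hc : (starRingEnd ℂ) (z ^ (-s)) = z ^ s := by
    rw [← Complex.inv_eq_conj (by rw [norm_zpow, hz, one_zpow]), zpow_neg, inv_inv]
  have h4 : z * (z ^ s * z ^ (-(s + 1))) = 1 := by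
    rw [← zpow_add₀ hz0]
    have : s + -(s + 1) = -1 := by ring
    rw [this, zpow_neg_one, mul_inv_cancel₀ hz0]
  rw [hc]
  congr 1
  linear_combination (inner ℂ (u s) (u (s + 1))) * h4

theorem add_one_div_im_of_norm_eq_one {z : ℂ} (hz : ‖z‖ = 1) : (z + 1 / z).im = 0 := by
  rw [one_div, Complex.inv_eq_conj hz]
  simp

/-- A bounded solution `u = -G V u`, with `G` the free Green operator on the unit circle, carries
no outgoing wave. -/
theorem tsum_zpow_smul_eq_zero [CompleteSpace F] {V : ℤ → F →L[ℂ] F}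
    (hV : ∀ n a b, inner ℂ (V n a) b = inner ℂ a (V n b)) {z : ℂ} (hz : ‖z‖ = 1)
    (hz1 : z ^ 2 ≠ 1) {f u : ℤ → F} (hf : Summable fun r => ‖f r‖)
    (hu : ∀ s, u s = ∑' r, green z (s - r) • f r)
    (heq : ∀ n, u (n + 1) + u (n - 1) + V n (u n) = (z + 1 / z) • u n) :
    ∑' r, z ^ (-r) • f r = 0 := by
  have hz0 : z ≠ 0 := norm_pos_iff.1 (by rw [hz]; exact one_pos)
  set w : ℤ → ℝ := fun n => (inner ℂ (u n) (u (n + 1))).im with hw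
  have step : ∀ n, w (n - 1) = w n := fun n => by
    have := wronskian_sub hV heq n
    rw [add_one_div_im_of_norm_eq_one hz, zero_mul] at this
    simp only [hw, sub_add_cancel]
    linarith
  have hconst : ∀ n, w n = w 0 := fun n => by
    induction n using Int.induction_on with
    | zero => rfl
    | succ i ih => rw [← ih, ← step, add_sub_cancel_right]
    | pred i ih => rw [← ih, step]
  have t1 : Tendsto (fun s : ℤ => z ^ (-s) • u s) atTop
      (𝓝 ((z / (z ^ 2 - 1)) • ∑' r, z ^ (-r) • f r)) := by
    simpa only [← hu] using tendsto_green_convolution_atTop hz hf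
  -- `green` is even, so reflection turns the behaviour at `-∞` into the case already treated.
  have hu' : ∀ s, u (-s) = ∑' r, green z (s - r) • f (-r) := fun s => by
    rw [hu, ← (Equiv.neg ℤ).tsum_eq]
    refine tsum_congr fun r => ?_
    rw [Equiv.neg_apply, ← green_neg]
    congr 2
    ring
  have hf' : Summable fun r => ‖f (-r)‖ := hf.comp_injective (i := fun r : ℤ => -r) neg_injective
  have t2 : Tendsto (fun s : ℤ => z ^ (-s) • u (-s)) atTop
      (𝓝 ((z / (z ^ 2 - 1)) • ∑' r, z ^ (-r) • f (-r))) := by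
    simpa only [← hu'] using tendsto_green_convolution_atTop (f := fun r => f (-r)) hz hf'
  have e1 := tendsto_nhds_unique (tendsto_const_nhds.congr fun s => (hconst s).symm)
    (tendsto_wronskian_of_tendsto hz t1)
  -- Reflection exchanges the two arguments of the inner product, hence the minus sign.
  have e2 : -w 0 = _ := tendsto_nhds_unique (tendsto_const_nhds.congr fun s => by
    rw [← hconst (-s - 1)]
    simp only [hw, sub_add_cancel]
    rw [← Complex.conj_im, inner_conj_symm, neg_add'])
    (tendsto_wronskian_of_tendsto (u := fun s => u (-s)) hz t2)
  have him : z.im ≠ 0 := by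
    intro him
    apply hz1
    have h1 := Complex.conj_eq_iff_im.2 him
    have h2 := Complex.inv_eq_conj hz
    rw [h1] at h2
    rw [pow_two]
    nth_rewrite 1 [← h2]
    exact inv_mul_cancel₀ hz0
  set x := ‖(z / (z ^ 2 - 1)) • ∑' r, z ^ (-r) • f r‖ with hx
  set y := ‖(z / (z ^ 2 - 1)) • ∑' r, z ^ (-r) • f (-r)‖
  -- The two fluxes are opposite multiples of squares with the same factor `Im z`, which is nonzero
  -- since `z ≠ ±1`.
  have h0 : z.im * (x ^ 2 + y ^ 2) = 0 := by linarith
  have h1 : x ^ 2 + y ^ 2 = 0 := by simpa [him] using h0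
  have h2 : x = 0 := by nlinarith [sq_nonneg x, sq_nonneg y]
  rw [hx, norm_eq_zero, smul_eq_zero] at h2
  exact h2.resolve_left (div_ne_zero hz0 (sub_ne_zero.2 hz1))

theorem exists_tail_le {v : ℤ → ℝ} (hv : Summable v) (hv0 : ∀ n, 0 ≤ v n) {ε : ℝ} (hε : 0 < ε) :
    ∃ N : ℤ, ∑' r, (if N < r then v r else 0) ≤ ε := by
  have h : Tendsto (fun N : ℤ => ∑' r, (if N < r then v r else 0)) atTop (𝓝 (∑' _ : ℤ, (0 : ℝ))) := by
    refine tendsto_tsum_of_dominated_convergence hv (fun r => ?_) (.of_forall fun s r => ?_)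
    · refine tendsto_const_nhds.congr' ?_
      filter_upwards [eventually_ge_atTop r] with N hN
      rw [if_neg (by omega)]
    · split_ifs
      · rw [Real.norm_of_nonneg (hv0 r)]
      · simpa using hv0 r
  rw [tsum_zero] at h
  obtain ⟨N, hN⟩ := (h.eventually_le_const hε).exists
  exact ⟨N, hN⟩

/-- Subtracting the vanishing plane wave `c z ^ s ∑ z ^ (-r) • f r` cancels every term with `r ≤ s`
exactly; each remaining coefficient is at most twice the Green bound. -/
theorem norm_green_convolution_le_tail [CompleteSpace F] {z : ℂ} (hz : ‖z‖ = 1) {f : ℤ → F}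
    (hf : Summable fun r => ‖f r‖) (h0 : ∑' r, z ^ (-r) • f r = 0) (s : ℤ) :
    ‖∑' r, green z (s - r) • f r‖ ≤ ∑' r, (if s < r then 2 * ‖z ^ 2 - 1‖⁻¹ * ‖f r‖ else 0) := by
  have hz0 : z ≠ 0 := norm_pos_iff.1 (by rw [hz]; exact one_pos)
  set c := z / (z ^ 2 - 1) with hc
  have hcn : ‖c‖ = ‖z ^ 2 - 1‖⁻¹ := by rw [hc, norm_div, hz, one_div]
  have hs1 : Summable fun r => green z (s - r) • f r :=
    .of_norm_bounded (hf.mul_left ‖z ^ 2 - 1‖⁻¹) fun r => by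
      rw [norm_smul]
      gcongr
      exact norm_green_le hz.le _
  have hs2 : Summable fun r => z ^ (-r) • f r :=
    .of_norm_bounded hf fun r => by rw [norm_smul, norm_zpow, hz, one_zpow, one_mul]
  have e : ∑' r, green z (s - r) • f r
      = ∑' r, (green z (s - r) • f r - (c * z ^ s) • z ^ (-r) • f r) := by
    rw [hs1.tsum_sub (hs2.const_smul _), hs2.tsum_const_smul, h0, smul_zero, sub_zero]
  rw [e]
  have hsum : Summable fun r => (if s < r then 2 * ‖z ^ 2 - 1‖⁻¹ * ‖f r‖ else 0) := by
    refine .of_nonneg_of_le (fun r => ?_) (fun r => ?_) (hf.mul_left (2 * ‖z ^ 2 - 1‖⁻¹))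
    · split_ifs <;> positivity
    · split_ifs
      · exact le_rfl
      · positivity
  refine (hs1.sub (hs2.const_smul (c * z ^ s))).hasSum.norm_le_of_bounded hsum.hasSum fun r => ?_
  by_cases h : s < r
  · rw [if_pos h, smul_smul, ← sub_smul, norm_smul]
    gcongr
    refine (norm_sub_le _ _).trans ?_
    rw [norm_mul, norm_mul, norm_zpow, norm_zpow, hz, one_zpow, one_zpow, mul_one, mul_one, hcn,
      two_mul]
    gcongr
    exact norm_green_le hz.le _
  · rw [if_neg h, green_eq_of_nonneg z (by omega), smul_smul, ← sub_smul, sub_eq_add_neg s r,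
      zpow_add₀ hz0, ← mul_assoc, sub_self, zero_smul, norm_zero]

/-- The recurrence determines `u (n - 1)` from `u n` and `u (n + 1)`, so two consecutive zeros
propagate to the left. -/
theorem eq_zero_of_eventually_zero {V : ℤ → F →L[ℂ] F} {u : ℤ → F} {E : ℂ}
    (hu : ∀ n, u (n + 1) + u (n - 1) + V n (u n) = E • u n) {N : ℤ} (hN : ∀ n, N ≤ n → u n = 0)
    (n : ℤ) : u n = 0 := by
  have key : ∀ m : ℕ, u (N - m) = 0 ∧ u (N - m + 1) = 0 := by
    intro m
    induction m with
    | zero => exact ⟨hN _ (by simp), hN _ (by simp)⟩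
    | succ m ih =>
      have h := hu (N - m)
      rw [ih.1, ih.2, map_zero, smul_zero, zero_add, add_zero] at h
      push_cast
      refine ⟨?_, ?_⟩
      · rw [← h]; congr 1; ring
      · rw [← ih.1]; congr 1; ring
  rcases le_total N n with h | h
  · exact hN n h
  · have := (key (N - n).toNat).1
    rw [Int.toNat_of_nonneg (by omega)] at this
    simpa using this

/-- There are no resonances on the unit circle away from `±1`. -/
theorem eq_zero_of_eq_neg_green_convolution [CompleteSpace F] {V : ℤ → F →L[ℂ] F}
    (hV : ∀ n a b, inner ℂ (V n a) b = inner ℂ a (V n b)) (hVs : Summable fun n => ‖V n‖)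
    {z : ℂ} (hz : ‖z‖ = 1) (hz1 : z ^ 2 ≠ 1) {f u : ℤ → F} (hf : Summable fun r => ‖f r‖)
    (hu : ∀ s, u s = ∑' r, green z (s - r) • f r) (hfu : ∀ r, f r = -V r (u r))
    (heq : ∀ n, u (n + 1) + u (n - 1) + V n (u n) = (z + 1 / z) • u n) (n : ℤ) : u n = 0 := by
  have h0 := tsum_zpow_smul_eq_zero hV hz hz1 hf hu heq
  have hd : 0 < ‖z ^ 2 - 1‖⁻¹ := inv_pos.2 (norm_pos_iff.2 (sub_ne_zero.2 hz1))
  set d := ‖z ^ 2 - 1‖⁻¹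
  have tail : ∀ s, ‖u s‖ ≤ ∑' r, (if s < r then 2 * d * ‖f r‖ else 0) := fun s => by
    rw [hu s]
    exact norm_green_convolution_le_tail hz hf h0 s
  -- Beyond `N` the potential is so small that the tail bound for `u` contracts by the factor `1/2`;
  -- iterating it gives `bound`.
  obtain ⟨N, hN⟩ := exists_tail_le (hVs.mul_left (2 * d)) (fun n => by positivity)
    (show (0 : ℝ) < 1 / 2 by norm_num)
  set C := ∑' r, 2 * d * ‖f r‖
  have hC0 : 0 ≤ C := tsum_nonneg fun r => by positivity
  have hVN : Summable fun r => (if N < r then 2 * d * ‖V r‖ else 0) := by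
    refine .of_nonneg_of_le (fun r => ?_) (fun r => ?_) (hVs.mul_left (2 * d))
    · split_ifs <;> positivity
    · split_ifs
      · exact le_rfl
      · positivity
  have hfs : ∀ s, Summable fun r => (if s < r then 2 * d * ‖f r‖ else 0) := fun s => by
    refine .of_nonneg_of_le (fun r => ?_) (fun r => ?_) (hf.mul_left (2 * d))
    · split_ifs <;> positivity
    · split_ifs
      · exact le_rfl
      · positivity
  have bound : ∀ k : ℕ, ∀ s, N ≤ s → ‖u s‖ ≤ C * (1 / 2) ^ k := by
    intro k
    induction k with
    | zero =>
      intro s _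
      rw [pow_zero, mul_one]
      refine (tail s).trans ((hfs s).tsum_le_tsum (fun r => ?_) (hf.mul_left (2 * d)))
      split_ifs
      · exact le_rfl
      · positivity
    | succ k ih =>
      intro s hs
      have h1 : ∀ r, (if s < r then 2 * d * ‖f r‖ else 0)
          ≤ (if N < r then 2 * d * ‖V r‖ else 0) * (C * (1 / 2) ^ k) := fun r => by
        by_cases h : s < r
        · rw [if_pos h, if_pos (by omega), hfu, norm_neg, mul_assoc (2 * d)]
          gcongr
          refine ((V r).le_opNorm _).trans ?_
          gcongr
          exact ih r (by omega)
        · rw [if_neg h]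
          split_ifs <;> positivity
      refine (tail s).trans (((hfs s).tsum_le_tsum h1 (hVN.mul_right _)).trans ?_)
      rw [tsum_mul_right, pow_succ]
      have h2 : 0 ≤ C * (1 / 2) ^ k := by positivity
      nlinarith
  refine eq_zero_of_eventually_zero heq (N := N) (fun s hs => ?_) n
  have hlim : Tendsto (fun k : ℕ => C * (1 / 2 : ℝ) ^ k) atTop (𝓝 (C * 0)) :=
    (tendsto_pow_atTop_nhds_zero_of_lt_one (by norm_num) (by norm_num)).const_mul C
  rw [mul_zero] at hlim
  exact norm_le_zero_iff.1 (ge_of_tendsto' hlim fun k => bound k s hs)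

end Resonance

/-! ### Polynomial weights -/

section Weights

/-- The weight `1 + |n|`. -/
noncomputable def wt (n : ℤ) : ℝ := 1 + |(n : ℝ)|

theorem one_le_wt (n : ℤ) : 1 ≤ wt n := by
  rw [wt]
  linarith [abs_nonneg (n : ℝ)]

theorem wt_pos (n : ℤ) : 0 < wt n := one_pos.trans_le (one_le_wt n)

theorem wt_sub_le (s r : ℤ) : wt (s - r) ≤ wt s * wt r := by
  rw [wt, wt, wt]
  push_cast
  have h := abs_sub (s : ℝ) (r : ℝ)
  nlinarith [mul_nonneg (abs_nonneg (s : ℝ)) (abs_nonneg (r : ℝ))]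

/-- Growth in `s - r` is removed from the column index by one input weight, at the price of one
output factor `wt s ^ θ`. -/
theorem wt_rpow_sub_mul_le {θ : ℝ} (hθ : 0 ≤ θ) (s r : ℤ) :
    wt (s - r) ^ θ * wt r ^ (-θ) ≤ wt s ^ θ := by
  rw [Real.rpow_neg (wt_pos r).le, ← div_eq_mul_inv,
    div_le_iff₀ (Real.rpow_pos_of_pos (wt_pos r) θ), ← Real.mul_rpow (wt_pos s).le (wt_pos r).le]
  exact Real.rpow_le_rpow (wt_pos _).le (wt_sub_le s r) hθ

theorem wt_rpow_neg_le_one {θ : ℝ} (hθ : 0 ≤ θ) (n : ℤ) : wt n ^ (-θ) ≤ 1 :=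
  Real.rpow_le_one_of_one_le_of_nonpos (one_le_wt n) (by linarith)

theorem wt_rpow_neg_mul_rpow (θ : ℝ) (n : ℤ) : wt n ^ (-θ) * wt n ^ θ = 1 := by
  rw [← Real.rpow_add (wt_pos n), neg_add_cancel, Real.rpow_zero]

theorem norm_wt_rpow (θ : ℝ) (n : ℤ) : ‖((wt n ^ θ : ℝ) : ℂ)‖ = wt n ^ θ := by
  rw [Complex.norm_real, Real.norm_of_nonneg (Real.rpow_nonneg (wt_pos n).le θ)]

theorem summable_wt_rpow {p : ℝ} (hp : p < -1) : Summable fun n : ℤ => wt n ^ p := by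
  have h : Summable fun n : ℕ => ((n + 1 : ℕ) : ℝ) ^ p :=
    (summable_nat_add_iff 1).2 (Real.summable_nat_rpow.2 hp)
  refine Summable.of_nat_of_neg (h.congr fun n => ?_) (h.congr fun n => ?_) <;>
  · rw [wt]
    push_cast
    simp [add_comm]

theorem memℓp_two_wt_rpow {p : ℝ} (hp : p < -(1 / 2)) : Memℓp (fun n : ℤ => wt n ^ p) 2 := by
  rw [memℓp_gen_iff (p := 2) (by norm_num)]
  refine (summable_wt_rpow (p := p * 2) (by linarith)).congr fun n => ?_
  rw [Real.norm_of_nonneg (Real.rpow_nonneg (wt_pos n).le p), Real.rpow_mul (wt_pos n).le]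
  norm_num

end Weights

/-! ### The Birman–Schwinger operator and the weighted resolvent -/

section BirmanSchwinger

/-- The Fredholm alternative at the spectral value `-1`. -/
theorem isUnit_one_add_of_isCompactOperator {X : Type*} [NormedAddCommGroup X] [NormedSpace ℂ X]
    [CompleteSpace X] {T : X →L[ℂ] X} (hT : IsCompactOperator T) (h : ∀ x, x + T x = 0 → x = 0) :
    IsUnit (1 + T) := by
  rcases hT.hasEigenvalue_or_mem_resolventSet (μ := -1) (by norm_num) with h1 | h1
  · obtain ⟨x, hx⟩ := h1.exists_hasEigenvector
    refine absurd (h x ?_) hx.2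
    have := hx.apply_eq_smul
    rw [ContinuousLinearMap.coe_coe] at this
    rw [this]
    simp
  · rw [spectrum.mem_resolventSet_iff, ← IsUnit.neg_iff] at h1
    convert h1 using 1
    simp [add_comm]

variable {F : Type*} [NormedAddCommGroup F] [NormedSpace ℂ F]

/-- Multiplication by `(1 + |n|)^{-θ}` on `ℓ¹`. -/
noncomputable def weightOp (F : Type*) [NormedAddCommGroup F] [NormedSpace ℂ F] {θ : ℝ}
    (hθ : 0 ≤ θ) : lp (fun _ : ℤ => F) 1 →L[ℂ] lp (fun _ : ℤ => F) 1 :=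
  diagOp 1 (fun n => ((wt n ^ (-θ) : ℝ) : ℂ)) fun n => by
    rw [norm_wt_rpow]
    exact wt_rpow_neg_le_one hθ n

theorem weightOp_apply {θ : ℝ} (hθ : 0 ≤ θ) (x : lp (fun _ : ℤ => F) 1) (n : ℤ) :
    weightOp F hθ x n = ((wt n ^ (-θ) : ℝ) : ℂ) • x n := rfl

theorem weightOp_single {θ : ℝ} (hθ : 0 ≤ θ) (r : ℤ) (a : F) :
    weightOp F hθ (lp.single 1 r a) = lp.single 1 r (((wt r ^ (-θ) : ℝ) : ℂ) • a) :=
  diagOp_single _ r a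

theorem eq_zero_of_weightOp_eq_zero {θ : ℝ} (hθ : 0 ≤ θ) {x : lp (fun _ : ℤ => F) 1}
    (h : ∀ s, weightOp F hθ x s = 0) : x = 0 := by
  refine lp.ext (funext fun s => ?_)
  have h1 := h s
  rw [weightOp_apply, smul_eq_zero] at h1
  refine h1.resolve_left ?_
  exact_mod_cast (Real.rpow_pos_of_pos (wt_pos s) _).ne'

/-- The weight `(1 + |n|)^p` as an operator from `ℓ²` to `ℓ¹`. -/
noncomputable def weightTwoOne (F : Type*) [NormedAddCommGroup F] [NormedSpace ℂ F] {p : ℝ}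
    (hp : p < -(1 / 2)) : lp (fun _ : ℤ => F) 2 →L[ℂ] lp (fun _ : ℤ => F) 1 :=
  diagTwoOne ⟨fun n => ((wt n ^ p : ℝ) : ℂ), (memℓp_two_wt_rpow hp).mono' fun n => by
    rw [Complex.norm_real]⟩

theorem weightTwoOne_apply {p : ℝ} (hp : p < -(1 / 2)) (x : lp (fun _ : ℤ => F) 2) (n : ℤ) :
    weightTwoOne F hp x n = ((wt n ^ p : ℝ) : ℂ) • x n := rfl

/-- The kernel of `(1 + |n|)^θ V G`, where `G` is the free Green operator. -/
noncomputable def potentialKernel (V : ℤ → F →L[ℂ] F) (θ : ℝ) (z : ℂ) (s r : ℤ) : F →L[ℂ] F :=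
  (((wt s ^ θ : ℝ) : ℂ) * green z (s - r)) • V s

/-- The kernel of `(1 + |n|)^{-α} G`, where `G` is the free Green operator. -/
noncomputable def weightedGreenKernel (F : Type*) [NormedAddCommGroup F] [NormedSpace ℂ F]
    (α : ℝ) (z : ℂ) (s r : ℤ) : F →L[ℂ] F :=
  (((wt s ^ (-α) : ℝ) : ℂ) * green z (s - r)) • ContinuousLinearMap.id ℂ F

variable {V : ℤ → F →L[ℂ] F} {θ α δ : ℝ} {z w : ℂ}

theorem hasRowBound_potentialKernel (hV : Summable fun n => wt n ^ θ * ‖V n‖) (hz : ‖z‖ ≤ 1) :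
    HasRowBound 1 (potentialKernel V θ z) := by
  refine ⟨fun s => ‖z ^ 2 - 1‖⁻¹ * (wt s ^ θ * ‖V s‖),
    memℓp_one_of_summable (hV.mul_left _).norm, fun s r => ?_⟩
  rw [potentialKernel, norm_smul, norm_mul, norm_wt_rpow]
  have := norm_green_le hz (s - r)
  have h2 : 0 ≤ wt s ^ θ := Real.rpow_nonneg (wt_pos s).le θ
  calc wt s ^ θ * ‖green z (s - r)‖ * ‖V s‖ ≤ wt s ^ θ * ‖z ^ 2 - 1‖⁻¹ * ‖V s‖ := by gcongr
    _ = _ := by ring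

theorem hasRowBound_weightedGreenKernel (hα : 1 / 2 < α) (hz : ‖z‖ ≤ 1) :
    HasRowBound 2 (weightedGreenKernel F α z) := by
  refine ⟨fun s => ‖z ^ 2 - 1‖⁻¹ * wt s ^ (-α),
    (memℓp_two_wt_rpow (by linarith)).const_mul _, fun s r => ?_⟩
  rw [weightedGreenKernel, norm_smul, norm_mul, norm_wt_rpow]
  change _ ≤ ‖z ^ 2 - 1‖⁻¹ * wt s ^ (-α)
  rw [mul_comm ‖z ^ 2 - 1‖⁻¹]
  have h2 : 0 ≤ wt s ^ (-α) := Real.rpow_nonneg (wt_pos s).le _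
  have := norm_green_le hz (s - r)
  refine (mul_le_of_le_one_right (by positivity) ContinuousLinearMap.norm_id_le).trans ?_
  gcongr

variable [CompleteSpace F]

/-- `(1 + |n|)^θ V G` as an operator on `ℓ¹`. -/
noncomputable def potentialOp (V : ℤ → F →L[ℂ] F) (θ : ℝ) (z : ℂ) :
    lp (fun _ : ℤ => F) 1 →L[ℂ] lp (fun _ : ℤ => F) 1 :=
  kernelOp 1 (potentialKernel V θ z)

/-- `(1 + |n|)^{-α} G` as an operator from `ℓ¹` to `ℓ²`. -/
noncomputable def weightedGreenOp (F : Type*) [NormedAddCommGroup F] [NormedSpace ℂ F]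
    [CompleteSpace F] (α : ℝ) (z : ℂ) :
    lp (fun _ : ℤ => F) 1 →L[ℂ] lp (fun _ : ℤ => F) 2 :=
  kernelOp 2 (weightedGreenKernel F α z)

theorem potentialOp_single (hV : Summable fun n => wt n ^ θ * ‖V n‖) (hz : ‖z‖ ≤ 1) (r : ℤ)
    (a : F) (s : ℤ) : potentialOp V θ z (lp.single 1 r a) s
      = (((wt s ^ θ : ℝ) : ℂ) * green z (s - r)) • V s a :=
  kernelOp_single (hasRowBound_potentialKernel hV hz) r a s

theorem weightedGreenOp_single (hα : 1 / 2 < α) (hz : ‖z‖ ≤ 1) (r : ℤ) (a : F) (s : ℤ) :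
    weightedGreenOp F α z (lp.single 1 r a) s
      = (((wt s ^ (-α) : ℝ) : ℂ) * green z (s - r)) • a :=
  kernelOp_single (hasRowBound_weightedGreenKernel hα hz) r a s

theorem summable_green_smul (hz : ‖z‖ ≤ 1) (x : lp (fun _ : ℤ => F) 1) (s : ℤ) :
    Summable fun r => green z (s - r) • x r :=
  .of_norm_bounded ((lp.summable_norm_one x).mul_left ‖z ^ 2 - 1‖⁻¹) fun r => by
    rw [norm_smul]
    gcongr
    exact norm_green_le hz _

theorem potentialOp_apply (hV : Summable fun n => wt n ^ θ * ‖V n‖) (hz : ‖z‖ ≤ 1)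
    (x : lp (fun _ : ℤ => F) 1) (s : ℤ) : potentialOp V θ z x s
      = ((wt s ^ θ : ℝ) : ℂ) • V s (∑' r, green z (s - r) • x r) := by
  rw [potentialOp, kernelOp_apply (hasRowBound_potentialKernel hV hz),
    (V s).map_tsum (summable_green_smul hz x s),
    ← ((summable_green_smul hz x s).mapL (V s)).tsum_const_smul]
  refine tsum_congr fun r => ?_
  rw [potentialKernel, smul_apply, map_smul, smul_smul]

theorem weightedGreenOp_apply (hα : 1 / 2 < α) (hz : ‖z‖ ≤ 1) (x : lp (fun _ : ℤ => F) 1) (s : ℤ) :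
    weightedGreenOp F α z x s
      = ((wt s ^ (-α) : ℝ) : ℂ) • ∑' r, green z (s - r) • x r := by
  rw [weightedGreenOp, kernelOp_apply (hasRowBound_weightedGreenKernel hα hz),
    ← (summable_green_smul hz x s).tsum_const_smul]
  refine tsum_congr fun r => ?_
  rw [weightedGreenKernel, smul_apply, smul_smul]
  rfl

/-- The majorant `(1 + |n|)^θ ‖V(n)‖`. -/
noncomputable def potentialMajorant (hV : Summable fun n => wt n ^ θ * ‖V n‖) :
    lp (fun _ : ℤ => ℝ) 1 :=
  ⟨fun n => wt n ^ θ * ‖V n‖, memℓp_one_of_summable hV.norm⟩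

/-- The sequence `(1 + |n|)^p`. -/
noncomputable def wtSeq {p : ℝ} (hp : p < -(1 / 2)) : lp (fun _ : ℤ => ℝ) 2 :=
  ⟨fun n => wt n ^ p, memℓp_two_wt_rpow hp⟩

theorem norm_potentialOp_le (hV : Summable fun n => wt n ^ θ * ‖V n‖) (hδ : 0 < δ) (hz : ‖z‖ ≤ 1)
    (hzδ : δ ≤ ‖z ^ 2 - 1‖) : ‖potentialOp V θ z‖ ≤ δ⁻¹ * ‖potentialMajorant hV‖ := by
  refine lp.opNorm_le_of_single _ _ (by positivity) fun r a s => ?_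
  have h1 : ‖green z (s - r)‖ ≤ δ⁻¹ := (norm_green_le hz _).trans (inv_anti₀ hδ hzδ)
  have h2 : 0 ≤ wt s ^ θ := Real.rpow_nonneg (wt_pos s).le θ
  have h3 : ‖potentialMajorant hV s‖ = wt s ^ θ * ‖V s‖ :=
    Real.norm_of_nonneg (mul_nonneg h2 (norm_nonneg _))
  rw [potentialOp_single hV hz, norm_smul, norm_mul, norm_wt_rpow, h3]
  calc wt s ^ θ * ‖green z (s - r)‖ * ‖V s a‖ ≤ wt s ^ θ * δ⁻¹ * (‖V s‖ * ‖a‖) := by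
        gcongr
        exact (V s).le_opNorm a
    _ = _ := by ring

theorem norm_weightedGreenOp_le (hα : 1 / 2 < α) (hδ : 0 < δ) (hz : ‖z‖ ≤ 1)
    (hzδ : δ ≤ ‖z ^ 2 - 1‖) :
    ‖weightedGreenOp F α z‖ ≤ δ⁻¹ * ‖wtSeq (show -α < -(1 / 2) by linarith)‖ := by
  refine lp.opNorm_le_of_single _ _ (by positivity) fun r a s => ?_
  have h1 : ‖green z (s - r)‖ ≤ δ⁻¹ := (norm_green_le hz _).trans (inv_anti₀ hδ hzδ)
  have h2 : 0 ≤ wt s ^ (-α) := Real.rpow_nonneg (wt_pos s).le _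
  have h3 : ‖wtSeq (show -α < -(1 / 2) by linarith) s‖ = wt s ^ (-α) := Real.norm_of_nonneg h2
  rw [weightedGreenOp_single hα hz, norm_smul, norm_mul, norm_wt_rpow, h3,
    mul_comm (wt s ^ (-α))]
  gcongr

/-- The input weight trades `wt (s - r) ^ θ` for `wt s ^ θ`, leaving the row majorant `wt s ^ (θ -
α)`; it is square summable because `α > θ + 1/2`. -/
theorem norm_weightedGreenOp_sub_comp_le (hθ : 0 ≤ θ) (hθ1 : θ ≤ 1) (hα : θ + 1 / 2 < α)
    (hδ : 0 < δ) (hz : ‖z‖ ≤ 1) (hw : ‖w‖ ≤ 1) (hzδ : δ ≤ ‖z ^ 2 - 1‖)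
    (hwδ : δ ≤ ‖w ^ 2 - 1‖) :
    ‖(weightedGreenOp F α z - weightedGreenOp F α w).comp (weightOp F hθ)‖
      ≤ (2 / δ + 2 / δ ^ 2) * ‖z - w‖ ^ θ
        * ‖wtSeq (show θ - α < -(1 / 2) by linarith)‖ := by
  have hr := Real.rpow_nonneg (norm_nonneg (z - w)) θ
  refine lp.opNorm_le_of_single _ _ (by positivity) fun r a s => ?_
  have h2 : 0 ≤ wt s ^ (-α) := Real.rpow_nonneg (wt_pos s).le _
  have h3 : ‖wtSeq (show θ - α < -(1 / 2) by linarith) s‖ = wt s ^ (-α) * wt s ^ θ := by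
    rw [← Real.rpow_add (wt_pos s), neg_add_eq_sub]
    exact Real.norm_of_nonneg (Real.rpow_nonneg (wt_pos s).le _)
  have h4 := norm_green_sub_le hδ hθ hθ1 hz hw hzδ hwδ (s - r)
  have h5 := wt_rpow_sub_mul_le hθ s r
  have h6 : 0 ≤ wt r ^ (-θ) := Real.rpow_nonneg (wt_pos r).le _
  rw [ContinuousLinearMap.comp_apply, weightOp_single, sub_apply,
    lp.coeFn_sub, Pi.sub_apply, weightedGreenOp_single (by linarith) hz,
    weightedGreenOp_single (by linarith) hw, ← sub_smul, ← mul_sub, norm_smul, norm_mul,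
    norm_wt_rpow, norm_smul, norm_wt_rpow, h3]
  calc wt s ^ (-α) * ‖green z (s - r) - green w (s - r)‖ * (wt r ^ (-θ) * ‖a‖)
      ≤ wt s ^ (-α) * ((2 / δ + 2 / δ ^ 2) * (wt (s - r) ^ θ * ‖z - w‖ ^ θ))
        * (wt r ^ (-θ) * ‖a‖) := by gcongr; exact h4
    _ = (2 / δ + 2 / δ ^ 2) * ‖z - w‖ ^ θ * wt s ^ (-α) * (wt (s - r) ^ θ * wt r ^ (-θ))
        * ‖a‖ := by ring
    _ ≤ (2 / δ + 2 / δ ^ 2) * ‖z - w‖ ^ θ * wt s ^ (-α) * wt s ^ θ * ‖a‖ := by gcongr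
    _ = _ := by ring

theorem potentialOp_sub_comp_single (hV : Summable fun n => wt n ^ θ * ‖V n‖) (hθ : 0 ≤ θ)
    (hz : ‖z‖ ≤ 1) (hw : ‖w‖ ≤ 1) (r : ℤ) (a : F) (s : ℤ) :
    ‖(potentialOp V θ z - potentialOp V θ w).comp (weightOp F hθ) (lp.single 1 r a) s‖
      ≤ wt s ^ θ * ‖V s‖ * (‖green z (s - r) - green w (s - r)‖ * wt r ^ (-θ)) * ‖a‖ := by
  have h2 : 0 ≤ wt s ^ θ := Real.rpow_nonneg (wt_pos s).le _
  have h6 : 0 ≤ wt r ^ (-θ) := Real.rpow_nonneg (wt_pos r).le _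
  rw [ContinuousLinearMap.comp_apply, weightOp_single, sub_apply,
    lp.coeFn_sub, Pi.sub_apply, potentialOp_single hV hz, potentialOp_single hV hw, ← sub_smul,
    ← mul_sub, norm_smul, norm_mul, norm_wt_rpow, map_smul, norm_smul, norm_wt_rpow]
  calc wt s ^ θ * ‖green z (s - r) - green w (s - r)‖ * (wt r ^ (-θ) * ‖V s a‖)
      ≤ wt s ^ θ * ‖green z (s - r) - green w (s - r)‖ * (wt r ^ (-θ) * (‖V s‖ * ‖a‖)) := by
        gcongr
        exact (V s).le_opNorm a
    _ = _ := by ring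

/-- The outer weight cancels the factor `wt s ^ θ` in the potential kernel, so the one produced by
the Green difference is paid by the `θ`-moment of `V`. Without it this estimate would need `2θ`
moments. -/
theorem norm_weightOp_comp_potentialOp_sub_comp_le (hV : Summable fun n => wt n ^ θ * ‖V n‖)
    (hθ : 0 ≤ θ) (hθ1 : θ ≤ 1) (hδ : 0 < δ) (hz : ‖z‖ ≤ 1) (hw : ‖w‖ ≤ 1)
    (hzδ : δ ≤ ‖z ^ 2 - 1‖) (hwδ : δ ≤ ‖w ^ 2 - 1‖) :
    ‖(weightOp F hθ).comp ((potentialOp V θ z - potentialOp V θ w).comp (weightOp F hθ))‖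
      ≤ (2 / δ + 2 / δ ^ 2) * ‖z - w‖ ^ θ * ‖potentialMajorant hV‖ := by
  have hr := Real.rpow_nonneg (norm_nonneg (z - w)) θ
  refine lp.opNorm_le_of_single _ _ (by positivity) fun r a s => ?_
  have h2 : 0 ≤ wt s ^ θ := Real.rpow_nonneg (wt_pos s).le _
  have h2' : 0 ≤ wt s ^ (-θ) := Real.rpow_nonneg (wt_pos s).le _
  have h3 : ‖potentialMajorant hV s‖ = wt s ^ θ * ‖V s‖ :=
    Real.norm_of_nonneg (mul_nonneg h2 (norm_nonneg _))
  have h4 := norm_green_sub_le hδ hθ hθ1 hz hw hzδ hwδ (s - r)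
  have h5 := wt_rpow_sub_mul_le hθ s r
  have h6 : 0 ≤ wt r ^ (-θ) := Real.rpow_nonneg (wt_pos r).le _
  rw [ContinuousLinearMap.comp_apply, weightOp_apply, norm_smul, norm_wt_rpow, h3]
  calc wt s ^ (-θ) * ‖(potentialOp V θ z - potentialOp V θ w).comp (weightOp F hθ)
        (lp.single 1 r a) s‖
      ≤ wt s ^ (-θ) * (wt s ^ θ * ‖V s‖
          * ((2 / δ + 2 / δ ^ 2) * (wt (s - r) ^ θ * ‖z - w‖ ^ θ) * wt r ^ (-θ)) * ‖a‖) := by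
        refine mul_le_mul_of_nonneg_left
          ((potentialOp_sub_comp_single hV hθ hz hw r a s).trans ?_) h2'
        gcongr
        exact h4
    _ = (wt s ^ (-θ) * wt s ^ θ) * ‖V s‖ * ((2 / δ + 2 / δ ^ 2) * ‖z - w‖ ^ θ)
          * (wt (s - r) ^ θ * wt r ^ (-θ)) * ‖a‖ := by ring
    _ ≤ 1 * ‖V s‖ * ((2 / δ + 2 / δ ^ 2) * ‖z - w‖ ^ θ) * wt s ^ θ * ‖a‖ := by
        rw [wt_rpow_neg_mul_rpow]
        gcongr
    _ = _ := by ring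

/-- Without the outer weight the Hölder majorant need not be summable. Truncating it by the trivial
bound `2 / δ` keeps it summable and small termwise, which gives continuity but no rate. -/
theorem norm_potentialOp_sub_comp_le (hV : Summable fun n => wt n ^ θ * ‖V n‖)
    (hθ : 0 ≤ θ) (hθ1 : θ ≤ 1) (hδ : 0 < δ) (hz : ‖z‖ ≤ 1) (hw : ‖w‖ ≤ 1)
    (hzδ : δ ≤ ‖z ^ 2 - 1‖) (hwδ : δ ≤ ‖w ^ 2 - 1‖) :
    ‖(potentialOp V θ z - potentialOp V θ w).comp (weightOp F hθ)‖
      ≤ ∑' s, wt s ^ θ * ‖V s‖ *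
        min (2 / δ) ((2 / δ + 2 / δ ^ 2) * (wt s ^ θ * ‖z - w‖ ^ θ)) := by
  have hr := Real.rpow_nonneg (norm_nonneg (z - w)) θ
  have hnn : ∀ s, 0 ≤ wt s ^ θ := fun s => Real.rpow_nonneg (wt_pos s).le _
  have hmin : ∀ s, 0 ≤ min (2 / δ) ((2 / δ + 2 / δ ^ 2) * (wt s ^ θ * ‖z - w‖ ^ θ)) := fun s =>
    le_min (by positivity) (by have := hnn s; positivity)
  have hsum : Summable fun s => wt s ^ θ * ‖V s‖ *
        min (2 / δ) ((2 / δ + 2 / δ ^ 2) * (wt s ^ θ * ‖z - w‖ ^ θ)) := by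
    refine .of_nonneg_of_le (fun s => ?_) (fun s => ?_) (hV.mul_right (2 / δ))
    · have := hnn s
      have := hmin s
      positivity
    · have := hnn s
      gcongr
      exact min_le_left _ _
  let b : lp (fun _ : ℤ => ℝ) 1 := ⟨_, memℓp_one_of_summable hsum.norm⟩
  have hb : ∀ s, ‖b s‖ = wt s ^ θ * ‖V s‖ *
        min (2 / δ) ((2 / δ + 2 / δ ^ 2) * (wt s ^ θ * ‖z - w‖ ^ θ)) := fun s =>
    Real.norm_of_nonneg (by have := hnn s; have := hmin s; positivity)
  refine (lp.opNorm_le_of_single _ b zero_le_one fun r a s => ?_).trans_eq ?_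
  · rw [hb, one_mul]
    refine (potentialOp_sub_comp_single hV hθ hz hw r a s).trans ?_
    have h1 := hnn s
    have h6 : 0 ≤ wt r ^ (-θ) := Real.rpow_nonneg (wt_pos r).le _
    gcongr
    refine le_min ?_ ?_
    · refine (mul_le_of_le_one_right (norm_nonneg _) (wt_rpow_neg_le_one hθ r)).trans ?_
      refine (norm_sub_le _ _).trans ?_
      have h1 := (norm_green_le hz (s - r)).trans (inv_anti₀ hδ hzδ)
      have h2 := (norm_green_le hw (s - r)).trans (inv_anti₀ hδ hwδ)
      have h3 : 2 / δ = δ⁻¹ + δ⁻¹ := by ring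
      linarith
    · have h4 := norm_green_sub_le hδ hθ hθ1 hz hw hzδ hwδ (s - r)
      have h5 := wt_rpow_sub_mul_le hθ s r
      calc ‖green z (s - r) - green w (s - r)‖ * wt r ^ (-θ)
          ≤ (2 / δ + 2 / δ ^ 2) * (wt (s - r) ^ θ * ‖z - w‖ ^ θ) * wt r ^ (-θ) := by
            gcongr
            exact h4
        _ = (2 / δ + 2 / δ ^ 2) * ((wt (s - r) ^ θ * wt r ^ (-θ)) * ‖z - w‖ ^ θ) := by ring
        _ ≤ _ := by gcongr
  · rw [one_mul, lp.norm_one_eq_tsum]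
    exact tsum_congr hb

/-- The Birman–Schwinger operator `V G` on the weighted space of sequences with
`∑ (1 + |n|)^θ ‖f(n)‖ < ∞`, carried over to `ℓ¹`. -/
noncomputable def birmanSchwinger (V : ℤ → F →L[ℂ] F) (hθ : 0 ≤ θ) (z : ℂ) :
    lp (fun _ : ℤ => F) 1 →L[ℂ] lp (fun _ : ℤ => F) 1 :=
  (potentialOp V θ z).comp (weightOp F hθ)

/-- Dominated convergence in the truncated majorant. Norm continuity is all that is needed to bound
the inverse of `1 + V G` uniformly on compact sets. -/
theorem continuousOn_birmanSchwinger (hV : Summable fun n => wt n ^ θ * ‖V n‖)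
    (hθ : 0 < θ) (hθ1 : θ ≤ 1) {S : Set ℂ} (hδ : 0 < δ) (hS : ∀ z ∈ S, ‖z‖ ≤ 1)
    (hSδ : ∀ z ∈ S, δ ≤ ‖z ^ 2 - 1‖) : ContinuousOn (birmanSchwinger V hθ.le) S := by
  intro w hw
  have hnn : ∀ s, 0 ≤ wt s ^ θ := fun s => Real.rpow_nonneg (wt_pos s).le _
  have hdist : Tendsto (fun z : ℂ => ‖z - w‖ ^ θ) (𝓝[S] w) (𝓝 0) := by
    have h : Continuous fun z : ℂ => ‖z - w‖ ^ θ :=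
      (continuous_id.sub continuous_const).norm.rpow_const fun _ => Or.inr hθ.le
    have h1 := (h.tendsto w).mono_left (nhdsWithin_le_nhds (s := S))
    simpa [Real.zero_rpow hθ.ne'] using h1
  have hlim : Tendsto (fun z : ℂ => ∑' s, wt s ^ θ * ‖V s‖ *
        min (2 / δ) ((2 / δ + 2 / δ ^ 2) * (wt s ^ θ * ‖z - w‖ ^ θ))) (𝓝[S] w)
      (𝓝 (∑' _ : ℤ, (0 : ℝ))) := by
    refine tendsto_tsum_of_dominated_convergence (hV.mul_right (2 / δ)) (fun s => ?_)
      (.of_forall fun z s => ?_)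
    · have h1 := ((hdist.const_mul (wt s ^ θ)).const_mul (2 / δ + 2 / δ ^ 2))
      have h2 := ((tendsto_const_nhds (x := 2 / δ)).min h1).const_mul (wt s ^ θ * ‖V s‖)
      rwa [mul_zero, mul_zero, min_eq_right (by positivity), mul_zero] at h2
    · have h1 := hnn s
      have h2 := Real.rpow_nonneg (norm_nonneg (z - w)) θ
      rw [Real.norm_of_nonneg (mul_nonneg (by positivity) (le_min (by positivity) (by positivity)))]
      gcongr
      exact min_le_left _ _
  rw [tsum_zero] at hlim
  rw [ContinuousWithinAt, tendsto_iff_norm_sub_tendsto_zero]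
  refine squeeze_zero' (.of_forall fun _ => norm_nonneg _) ?_ hlim
  filter_upwards [self_mem_nhdsWithin] with z hz
  exact norm_potentialOp_sub_comp_le hV hθ.le hθ1 hδ (hS z hz) (hS w hw) (hSδ z hz) (hSδ w hw)

theorem isCompactOperator_birmanSchwinger [FiniteDimensional ℂ F]
    (hV : Summable fun n => wt n ^ θ * ‖V n‖) (hθ : 0 ≤ θ) (hz : ‖z‖ ≤ 1) :
    IsCompactOperator (birmanSchwinger V hθ z) := by
  refine IsCompactOperator.comp_clm ?_ (weightOp F hθ)
  refine isCompactOperator_of_single (potentialOp V θ z) (hV.mul_left ‖z ^ 2 - 1‖⁻¹)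
    fun r a s => ?_
  have h1 := norm_green_le hz (s - r)
  have h2 : 0 ≤ wt s ^ θ := Real.rpow_nonneg (wt_pos s).le _
  rw [potentialOp_single hV hz, norm_smul, norm_mul, norm_wt_rpow]
  calc wt s ^ θ * ‖green z (s - r)‖ * ‖V s a‖
      ≤ wt s ^ θ * ‖z ^ 2 - 1‖⁻¹ * (‖V s‖ * ‖a‖) := by
        gcongr
        exact (V s).le_opNorm a
    _ = _ := by ring

/-- If `(1 + V G) f = g`, then `f + V u = g` for `u = G f`. -/
theorem add_potential_of_birmanSchwinger (hV : Summable fun n => wt n ^ θ * ‖V n‖) (hθ : 0 ≤ θ)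
    (hz : ‖z‖ ≤ 1) {x y : lp (fun _ : ℤ => F) 1} (h : (1 + birmanSchwinger V hθ z) x = y) (s : ℤ) :
    weightOp F hθ x s + V s (∑' r, green z (s - r) • weightOp F hθ x r) = weightOp F hθ y s := by
  have h1 := congrArg (fun t : lp (fun _ : ℤ => F) 1 => ((wt s ^ (-θ) : ℝ) : ℂ) • t s) h
  have h2 : (1 + birmanSchwinger V hθ z) x s
      = x s + potentialOp V θ z (weightOp F hθ x) s := rfl
  simp only [h2] at h1
  rw [potentialOp_apply hV hz, smul_add, smul_smul, ← Complex.ofReal_mul, wt_rpow_neg_mul_rpow,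
    Complex.ofReal_one, one_smul] at h1
  exact h1

theorem schrodinger_equation_of_birmanSchwinger (hV : Summable fun n => wt n ^ θ * ‖V n‖)
    (hθ : 0 ≤ θ) (hz : ‖z‖ ≤ 1) (h0 : z ≠ 0) (hz1 : z ^ 2 ≠ 1) {x y : lp (fun _ : ℤ => F) 1}
    (h : (1 + birmanSchwinger V hθ z) x = y) {u : ℤ → F}
    (hu : ∀ s, u s = ∑' r, green z (s - r) • weightOp F hθ x r) (s : ℤ) :
    u (s + 1) + u (s - 1) + V s (u s) = (z + 1 / z) • u s + weightOp F hθ y s := by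
  have h1 := add_potential_of_birmanSchwinger hV hθ hz h s
  have h2 := green_convolution_equation h0 hz1
    (summable_green_smul hz (weightOp F hθ x)) s
  rw [hu, hu, h2, ← hu, ← h1, ← hu]
  abel

/-- The operator `1 + V G` is invertible if the Schrödinger equation has no nonzero solution of the
form `u = G f` with `f` in the weighted space. -/
theorem isUnit_one_add_birmanSchwinger [FiniteDimensional ℂ F]
    (hV : Summable fun n => wt n ^ θ * ‖V n‖) (hθ : 0 ≤ θ) (hz : ‖z‖ ≤ 1) (h0 : z ≠ 0)
    (hz1 : z ^ 2 ≠ 1)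
    (h : ∀ (f : lp (fun _ : ℤ => F) 1) (u : ℤ → F), (∀ s, u s = ∑' r, green z (s - r) • f r) →
      (∀ s, f s = -V s (u s)) →
      (∀ s, u (s + 1) + u (s - 1) + V s (u s) = (z + 1 / z) • u s) → ∀ s, u s = 0) :
    IsUnit (1 + birmanSchwinger V hθ z) := by
  refine isUnit_one_add_of_isCompactOperator (isCompactOperator_birmanSchwinger hV hθ hz)
    fun x hx => ?_
  have hx' : (1 + birmanSchwinger V hθ z) x = 0 := hx
  have hf : ∀ s, weightOp F hθ x s = -V s (∑' r, green z (s - r) • weightOp F hθ x r) := fun s => by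
    have := add_potential_of_birmanSchwinger hV hθ hz hx' s
    rw [map_zero] at this
    exact eq_neg_of_add_eq_zero_left this
  have hu := h (weightOp F hθ x) (fun s => ∑' r, green z (s - r) • weightOp F hθ x r)
    (fun _ => rfl) hf fun s => by
      have := schrodinger_equation_of_birmanSchwinger hV hθ hz h0 hz1 hx' (fun _ => rfl) s
      rw [map_zero] at this
      exact this.trans (add_zero _)
  refine eq_zero_of_weightOp_eq_zero hθ fun s => ?_
  rw [hf, hu, map_zero, neg_zero]

/-- The weighted resolvent `T_{-α} G (1 + V G)⁻¹ T_{-α}`. -/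
noncomputable def weightedResolvent (V : ℤ → F →L[ℂ] F) (hθ : 0 ≤ θ) (hα : θ + 1 / 2 < α) (z : ℂ) :
    lp (fun _ : ℤ => F) 2 →L[ℂ] lp (fun _ : ℤ => F) 2 :=
  (weightedGreenOp F α z).comp ((weightOp F hθ).comp
    ((Ring.inverse (1 + birmanSchwinger V hθ z)).comp
      (weightTwoOne F (show θ - α < -(1 / 2) by linarith))))

/-- A second resolvent identity arranged so that `A - A'` occurs only between two weights `I`. The
point is `I M' = (1 - I M' A') I`: the weight is moved to the right of `M'`, next to the difference,
and the factor `1 - I M' A'` left behind is bounded. -/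
theorem resolvent_sub_eq {X Y : Type*} [NormedAddCommGroup X] [NormedSpace ℂ X]
    [NormedAddCommGroup Y] [NormedSpace ℂ Y] {Q Q' : X →L[ℂ] Y} {A A' I M M' : X →L[ℂ] X}
    (h : (1 + A * I) * M = 1) (h' : M' * (1 + A' * I) = 1) :
    Q.comp (I * M) - Q'.comp (I * M') =
      ((Q - Q').comp I).comp M - Q'.comp ((1 - I * M' * A') * (I * ((A - A') * I)) * M) := by
  have e1 : M - M' = -(M' * ((A - A') * I) * M) := by
    calc M - M' = M' * (1 + A' * I) * M - M' * ((1 + A * I) * M) := by rw [h, h', one_mul, mul_one]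
      _ = _ := by noncomm_ring
  have e2 : (1 - I * M' * A') * I = I * M' := by
    calc (1 - I * M' * A') * I = I * 1 - I * M' * A' * I := by noncomm_ring
      _ = I * (M' * (1 + A' * I)) - I * M' * A' * I := by rw [h']
      _ = _ := by noncomm_ring
  have e3 : (1 - I * M' * A') * (I * ((A - A') * I)) * M = -(I * (M - M')) := by
    calc _ = ((1 - I * M' * A') * I) * ((A - A') * I) * M := by noncomm_ring
      _ = _ := by rw [e2, e1]; noncomm_ring
  rw [e3]
  refine ContinuousLinearMap.ext fun x => ?_
  simp

theorem exists_norm_weightedResolvent_sub_le (hV : Summable fun n => wt n ^ θ * ‖V n‖)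
    (hθ : 0 ≤ θ) (hθ1 : θ ≤ 1) (hα : θ + 1 / 2 < α) {S : Set ℂ} (hδ : 0 < δ)
    (hS : ∀ z ∈ S, ‖z‖ ≤ 1) (hSδ : ∀ z ∈ S, δ ≤ ‖z ^ 2 - 1‖)
    (hu : ∀ z ∈ S, IsUnit (1 + birmanSchwinger V hθ z)) {m : ℝ}
    (hm : ∀ z ∈ S, ‖Ring.inverse (1 + birmanSchwinger V hθ z)‖ ≤ m) :
    ∃ C : ℝ, 0 ≤ C ∧ ∀ z ∈ S, ∀ w ∈ S,
      ‖weightedResolvent V hθ hα z - weightedResolvent V hθ hα w‖ ≤ C * ‖z - w‖ ^ θ := by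
  set D := 2 / δ + 2 / δ ^ 2
  have hD0 : 0 ≤ D := by positivity
  set q := ‖wtSeq (show θ - α < -(1 / 2) by linarith)‖
  set q' := ‖wtSeq (show -α < -(1 / 2) by linarith)‖
  set v := ‖potentialMajorant hV‖
  set I := weightOp F hθ
  set P := weightTwoOne F (show θ - α < -(1 / 2) by linarith)
  -- `|m|` rather than `m`: for empty `S` the bound does not force `m` to be nonnegative.
  refine ⟨(D * q * |m| + δ⁻¹ * q' * ((1 + ‖I‖ * |m| * (δ⁻¹ * v)) * (D * v) * |m|)) * ‖P‖,
    by positivity, fun z hz w hw => ?_⟩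
  have hx := Real.rpow_nonneg (norm_nonneg (z - w)) θ
  set x := ‖z - w‖ ^ θ
  set M := Ring.inverse (1 + birmanSchwinger V hθ z)
  set M' := Ring.inverse (1 + birmanSchwinger V hθ w)
  set A := potentialOp V θ z
  set A' := potentialOp V θ w
  set Q := weightedGreenOp F α z
  set Q' := weightedGreenOp F α w
  have e : weightedResolvent V hθ hα z - weightedResolvent V hθ hα w
      = (((Q - Q').comp I).comp M
        - Q'.comp ((1 - I * M' * A') * (I * ((A - A') * I)) * M)).comp P := by
    have h1 : (1 + A * I) * M = 1 := Ring.mul_inverse_cancel _ (hu z hz)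
    have h2 : M' * (1 + A' * I) = 1 := Ring.inverse_mul_cancel _ (hu w hw)
    rw [← resolvent_sub_eq h1 h2]
    rfl
  have b1 : ‖(Q - Q').comp I‖ ≤ D * x * q :=
    norm_weightedGreenOp_sub_comp_le hθ hθ1 hα hδ (hS z hz) (hS w hw) (hSδ z hz) (hSδ w hw)
  have b2 : ‖I * ((A - A') * I)‖ ≤ D * x * v :=
    norm_weightOp_comp_potentialOp_sub_comp_le hV hθ hθ1 hδ (hS z hz) (hS w hw) (hSδ z hz)
      (hSδ w hw)
  have b3 : ‖Q'‖ ≤ δ⁻¹ * q' := norm_weightedGreenOp_le (by linarith) hδ (hS w hw) (hSδ w hw)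
  have b4 : ‖A'‖ ≤ δ⁻¹ * v := norm_potentialOp_le hV hδ (hS w hw) (hSδ w hw)
  have b5 : ‖M‖ ≤ |m| := (hm z hz).trans (le_abs_self m)
  have b6 : ‖M'‖ ≤ |m| := (hm w hw).trans (le_abs_self m)
  have b7 : ‖1 - I * M' * A'‖ ≤ 1 + ‖I‖ * |m| * (δ⁻¹ * v) := by
    refine (norm_sub_le _ _).trans (add_le_add ContinuousLinearMap.norm_id_le ?_)
    refine (norm_mul_le _ _).trans ?_
    gcongr
    refine (norm_mul_le _ _).trans ?_
    gcongr
  rw [e]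
  refine (ContinuousLinearMap.opNorm_comp_le _ _).trans ?_
  calc _ ≤ (D * x * q * |m| + δ⁻¹ * q' * ((1 + ‖I‖ * |m| * (δ⁻¹ * v)) * (D * x * v) * |m|))
        * ‖P‖ := by
        gcongr
        refine (norm_sub_le _ _).trans (add_le_add ?_ ?_)
        · refine (ContinuousLinearMap.opNorm_comp_le _ _).trans ?_
          gcongr
        · refine (ContinuousLinearMap.opNorm_comp_le _ _).trans ?_
          gcongr
          refine (norm_mul_le _ _).trans ?_
          gcongr
          refine (norm_mul_le _ _).trans ?_
          gcongr
    _ = _ := by ring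

end BirmanSchwinger

/-! ### The inverse Zhukovsky map on a closed half-plane -/

section Zhukovsky

theorem sq_ne_one_of_add_one_div {z E : ℂ} (hz : z + 1 / z = E) (h2 : E ≠ 2) (h2' : E ≠ -2) :
    z ^ 2 ≠ 1 := by
  intro h
  rcases sq_eq_sq_iff_eq_or_eq_neg.1 (h.trans (one_pow 2).symm) with h | h
  · subst h
    exact h2 (by rw [← hz]; norm_num)
  · subst h
    exact h2' (by rw [← hz]; norm_num)

/-- The roots of `z² - E z + 1` have product `1`. If neither lies in the open disc, both have
modulus `1`, they are conjugate, and `E = 2 Re z` lies in the band. -/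
theorem exists_zhukovsky_eq {E : ℂ} (hE : E ∉ closedBand) :
    ∃ z ∈ {z : ℂ | z ≠ 0 ∧ ‖z‖ < 1}, zhukovsky z = E := by
  obtain ⟨d, hd⟩ := IsAlgClosed.exists_pow_nat_eq (E ^ 2 - 4) (n := 2) two_pos
  have key : ∀ z w : ℂ, z * w = 1 → z + w = E → ‖z‖ < 1 →
      ∃ z ∈ {z : ℂ | z ≠ 0 ∧ ‖z‖ < 1}, zhukovsky z = E := fun z w h1 h2 h3 => by
    have hz : z ≠ 0 := left_ne_zero_of_mul_eq_one h1
    refine ⟨z, ⟨hz, h3⟩, ?_⟩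
    rw [zhukovsky, ← h2, one_div, eq_inv_of_mul_eq_one_right h1]
  have hprod : (E + d) / 2 * ((E - d) / 2) = 1 := by linear_combination -hd / 4
  have hsum : (E + d) / 2 + (E - d) / 2 = E := by ring
  by_cases h1 : ‖(E + d) / 2‖ < 1
  · exact key _ _ hprod hsum h1
  by_cases h2 : ‖(E - d) / 2‖ < 1
  · exact key _ _ (by rw [mul_comm]; exact hprod) (by rw [add_comm]; exact hsum) h2
  exfalso
  push Not at h1 h2
  have h3 : ‖(E + d) / 2‖ * ‖(E - d) / 2‖ = 1 := by rw [← norm_mul, hprod, norm_one]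
  have h4 : ‖(E + d) / 2‖ = 1 := by nlinarith
  generalize (E + d) / 2 = z at *
  have h5 : E = z + (starRingEnd ℂ) z := by
    rw [← hsum, ← Complex.inv_eq_conj h4, eq_inv_of_mul_eq_one_right hprod]
  apply hE
  rw [h5, Complex.add_conj]
  have h6 := Complex.abs_re_le_norm z
  rw [h4] at h6
  refine ⟨by simp, ?_⟩
  rw [Complex.ofReal_re, abs_mul, abs_two]
  linarith

theorem mem_openBand_of_mem_closedBand {E : ℂ} (h : E ∈ closedBand) (h2 : E ≠ 2) (h2' : E ≠ -2) :
    E ∈ openBand := by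
  refine ⟨h.1, lt_of_le_of_ne h.2 fun he => ?_⟩
  rcases (abs_eq two_pos.le).1 he with h3 | h3
  · exact h2 (Complex.ext (by simpa using h3) (by simpa using h.1))
  · exact h2' (Complex.ext (by simpa using h3) (by simpa using h.1))

theorem zhukovskyInv_of_mem_closedBand (σ : ℤˣ) {E : ℂ} (hE : E ∈ closedBand) :
    zhukovskyInv σ E ≠ 0 ∧ ‖zhukovskyInv σ E‖ = 1 ∧
      zhukovskyInv σ E + 1 / zhukovskyInv σ E = E ∧
      ((σ : ℤ) : ℝ) * (zhukovskyInv σ E).im ≤ 0 := by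
  have hab := abs_le.1 hE.2
  set a := Real.arccos (E.re / 2) with ha
  have hz : zhukovskyInv σ E = Complex.exp (((-(((σ : ℤ) : ℝ) * a) : ℝ) : ℂ) * Complex.I) := by
    rw [zhukovskyInv, if_pos hE]
    congr 1
    push_cast
    ring
  have hn : ‖zhukovskyInv σ E‖ = 1 := by rw [hz, Complex.norm_exp_ofReal_mul_I]
  have hre : (zhukovskyInv σ E).re = E.re / 2 := by
    have hc : Real.cos a = E.re / 2 := Real.cos_arccos (by linarith) (by linarith)
    rw [hz, Complex.exp_ofReal_mul_I_re, Real.cos_neg]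
    rcases Int.units_eq_one_or σ with rfl | rfl <;> simpa using hc
  refine ⟨norm_pos_iff.1 (by rw [hn]; exact one_pos), hn, ?_, ?_⟩
  · rw [one_div, Complex.inv_eq_conj hn, Complex.add_conj, hre]
    exact Complex.ext (by simp [mul_div_cancel₀]) (by simpa using hE.1.symm)
  · have hs : 0 ≤ Real.sin a :=
      Real.sin_nonneg_of_nonneg_of_le_pi (Real.arccos_nonneg _) (Real.arccos_le_pi _)
    rw [hz, Complex.exp_ofReal_mul_I_im]
    rcases Int.units_eq_one_or σ with rfl | rfl <;> simpa using hs

theorem zhukovskyInv_of_notMem_closedBand (σ : ℤˣ) {E : ℂ} (hE : E ∉ closedBand)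
    (hσ : E ∈ closedHalfPlane σ) :
    zhukovskyInv σ E ≠ 0 ∧ ‖zhukovskyInv σ E‖ < 1 ∧
      zhukovskyInv σ E + 1 / zhukovskyInv σ E = E ∧
      ((σ : ℤ) : ℝ) * (zhukovskyInv σ E).im ≤ 0 := by
  have hz : zhukovskyInv σ E = Function.invFunOn zhukovsky {z : ℂ | z ≠ 0 ∧ ‖z‖ < 1} E := by
    rw [zhukovskyInv, if_neg hE]
  have h1 := Function.invFunOn_mem (exists_zhukovsky_eq hE)
  have h2 := Function.invFunOn_eq (exists_zhukovsky_eq hE)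
  rw [← hz] at h1 h2
  refine ⟨h1.1, h1.2, h2, ?_⟩
  generalize zhukovskyInv σ E = z at *
  have hpos : 0 < Complex.normSq z := Complex.normSq_pos.2 h1.1
  have hlt : Complex.normSq z < 1 := by
    rw [Complex.normSq_eq_norm_sq]
    exact pow_lt_one₀ (norm_nonneg z) h1.2 two_ne_zero
  -- Inside the disc `Im z` and `Im E` have opposite signs, so the closed half-plane goes to the
  -- opposite closed half-disc.
  have him : E.im * Complex.normSq z = z.im * (Complex.normSq z - 1) := by
    rw [← h2, zhukovsky, one_div, Complex.add_im, Complex.inv_im]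
    field_simp
    ring
  have hE' : 0 ≤ ((σ : ℤ) : ℝ) * E.im := hσ
  by_contra hcon
  push Not at hcon
  have h3 : ((σ : ℤ) : ℝ) * E.im * Complex.normSq z
      = ((σ : ℤ) : ℝ) * z.im * (Complex.normSq z - 1) := by linear_combination ((σ : ℤ) : ℝ) * him
  nlinarith [mul_nonneg hE' hpos.le]

theorem zhukovskyInv_spec (σ : ℤˣ) {E : ℂ} (hσ : E ∈ closedHalfPlane σ) :
    zhukovskyInv σ E ≠ 0 ∧ ‖zhukovskyInv σ E‖ ≤ 1 ∧
      zhukovskyInv σ E + 1 / zhukovskyInv σ E = E ∧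
      ((σ : ℤ) : ℝ) * (zhukovskyInv σ E).im ≤ 0 := by
  by_cases h : E ∈ closedBand
  · obtain ⟨h0, h1, h2, h3⟩ := zhukovskyInv_of_mem_closedBand σ h
    exact ⟨h0, h1.le, h2, h3⟩
  · obtain ⟨h0, h1, h2, h3⟩ := zhukovskyInv_of_notMem_closedBand σ h hσ
    exact ⟨h0, h1.le, h2, h3⟩

/-- A quantitative separation of `z w` from `1` on a closed half-disc, away from `±1`. -/
theorem norm_sq_sub_one_le {σ : ℤˣ} {z w : ℂ} (hz : ‖z‖ ≤ 1) (hw : ‖w‖ ≤ 1)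
    (hzi : ((σ : ℤ) : ℝ) * z.im ≤ 0) (hwi : ((σ : ℤ) : ℝ) * w.im ≤ 0) :
    ‖z ^ 2 - 1‖ ≤ 4 * ‖1 - z * w‖ := by
  have hzw : 0 ≤ z.im * w.im := by
    rcases Int.units_eq_one_or σ with rfl | rfl
    · simp at hzi hwi
      nlinarith
    · simp at hzi hwi
      positivity
  have hz2 : z.re ^ 2 + z.im ^ 2 ≤ 1 := by
    have := Complex.sq_norm z
    rw [Complex.normSq_apply] at this
    nlinarith [norm_nonneg z]
  have hw2 : w.re ^ 2 + w.im ^ 2 ≤ 1 := by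
    have := Complex.sq_norm w
    rw [Complex.normSq_apply] at this
    nlinarith [norm_nonneg w]
  have h1 : 1 - ‖z‖ ≤ ‖1 - z * w‖ := by
    have h := norm_sub_norm_le (1 : ℂ) (z * w)
    rw [norm_one, norm_mul] at h
    nlinarith [norm_nonneg z]
  -- This is where the common half-disc enters, through `Im z · Im w ≥ 0`; for `w` the conjugate of
  -- `z` on the unit circle the right side is zero.
  have h2 : |z.im| ≤ ‖1 - z * w‖ := by
    rw [← abs_of_nonneg (norm_nonneg (1 - z * w)), ← sq_le_sq, Complex.sq_norm,
      Complex.normSq_apply]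
    simp only [Complex.sub_re, Complex.sub_im, Complex.one_re, Complex.one_im, Complex.mul_re,
      Complex.mul_im]
    nlinarith [mul_nonneg (sub_nonneg.2 hz2) (sub_nonneg.2 hw2), sq_nonneg (z.re - w.re),
      sq_nonneg w.im]
  -- Splits `z² - 1` into a part of size at most `2 |Im z|` and one of size at most `2 (1 - ‖z‖)`;
  -- each is at most `2 ‖1 - z w‖`.
  have h3 : z ^ 2 - 1 = z * (z - (starRingEnd ℂ) z) - ((1 - ‖z‖ : ℝ) : ℂ) * ((1 + ‖z‖ : ℝ) : ℂ) := by
    have h := Complex.mul_conj z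
    rw [Complex.normSq_eq_norm_sq] at h
    push_cast at h ⊢
    linear_combination h
  rw [h3]
  refine (norm_sub_le _ _).trans ?_
  have h4 : ‖z * (z - (starRingEnd ℂ) z)‖ ≤ 1 * (2 * |z.im|) := by
    rw [norm_mul, Complex.sub_conj]
    gcongr
    rw [norm_mul, Complex.norm_I, mul_one, Complex.norm_real, Real.norm_eq_abs, abs_mul, abs_two]
  have h5 : ‖((1 - ‖z‖ : ℝ) : ℂ) * ((1 + ‖z‖ : ℝ) : ℂ)‖ ≤ (1 - ‖z‖) * 2 := by
    rw [norm_mul, Complex.norm_real, Complex.norm_real,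
      Real.norm_of_nonneg (sub_nonneg.2 hz), Real.norm_of_nonneg (by positivity)]
    have := sub_nonneg.2 hz
    gcongr
    linarith
  linarith

/-- From `(z² - 1)² = z² (E² - 4)` and `1 = z (E - z)`, which keeps `z` away from `0`, one gets `|z²
- 1|² ≥ |E² - 4| / (|E| + 1)²`. The right side is continuous and positive on `K`, so no continuity
of the branch is presupposed. -/
theorem exists_le_norm_zhukovskyInv_sq_sub_one {K : Set ℂ} (hK : IsCompact K) {σ : ℤˣ}
    (hKsub : K ⊆ closedHalfPlane σ) (h2 : ∀ E ∈ K, E ≠ 2 ∧ E ≠ -2) :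
    ∃ δ : ℝ, 0 < δ ∧ ∀ E ∈ K, δ ≤ ‖zhukovskyInv σ E ^ 2 - 1‖ := by
  have hf : ContinuousOn (fun E : ℂ => ‖E ^ 2 - 4‖ / (‖E‖ + 1) ^ 2) K := by
    refine Continuous.continuousOn ?_
    exact ((continuous_id.pow 2).sub continuous_const).norm.div
      ((continuous_norm.add continuous_const).pow 2) fun E => by positivity
  have hpos : ∀ E ∈ K, 0 < ‖E ^ 2 - 4‖ / (‖E‖ + 1) ^ 2 := fun E hE => by
    have h : E ^ 2 - 4 ≠ 0 := by
      have e : E ^ 2 - 4 = (E - 2) * (E - -2) := by ring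
      rw [e]
      exact mul_ne_zero (sub_ne_zero.2 (h2 E hE).1) (sub_ne_zero.2 (h2 E hE).2)
    have := norm_pos_iff.2 h
    positivity
  obtain ⟨c, hc, hcK⟩ := hK.exists_forall_le' hf hpos
  -- For `t < 1` one has `t² ≤ t`, so `c ≤ t²` rules out `t < min c 1`; this avoids the square root
  -- of `c`.
  refine ⟨min c 1, lt_min hc one_pos, fun E hE => ?_⟩
  obtain ⟨h0, h1, hE', -⟩ := zhukovskyInv_spec σ (hKsub hE)
  have hcE := hcK E hE
  generalize zhukovskyInv σ E = z at *
  have hz0 : 0 < ‖z‖ := norm_pos_iff.2 h0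
  have h3 : 1 ≤ ‖z‖ * (‖E‖ + 1) := by
    have e : (1 : ℂ) = z * (E - z) := by
      rw [← hE']
      field_simp
      ring
    have h4 : ‖E - z‖ ≤ ‖E‖ + 1 := (norm_sub_le _ _).trans (by linarith)
    calc (1 : ℝ) = ‖z‖ * ‖E - z‖ := by rw [← norm_mul, ← e, norm_one]
      _ ≤ _ := by gcongr
  have h5 : ‖z ^ 2 - 1‖ ^ 2 = ‖z‖ ^ 2 * ‖E ^ 2 - 4‖ := by
    rw [← norm_pow, ← norm_pow, ← norm_mul]
    congr 1
    rw [← hE']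
    field_simp
    ring
  have h6 : c ≤ ‖z ^ 2 - 1‖ ^ 2 := by
    rw [h5]
    have h7 : c * (‖E‖ + 1) ^ 2 ≤ ‖E ^ 2 - 4‖ := (le_div_iff₀ (by positivity)).1 hcE
    have h8 : 1 ≤ (‖z‖ * (‖E‖ + 1)) ^ 2 := one_le_pow₀ h3
    calc c ≤ c * (‖z‖ * (‖E‖ + 1)) ^ 2 := le_mul_of_one_le_right hc.le h8
      _ = ‖z‖ ^ 2 * (c * (‖E‖ + 1) ^ 2) := by ring
      _ ≤ _ := by gcongr
  by_contra hcon
  push Not at hcon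
  have h9 : ‖z ^ 2 - 1‖ < c := hcon.trans_le (min_le_left _ _)
  have h10 : ‖z ^ 2 - 1‖ < 1 := hcon.trans_le (min_le_right _ _)
  nlinarith [norm_nonneg (z ^ 2 - 1)]

/-- The identity `(z - w)(1 - z w) = -(E - E₀) z w` reduces the Lipschitz bound to a lower bound for
`|1 - z w|`. -/
theorem norm_zhukovskyInv_sub_le {K : Set ℂ} {σ : ℤˣ} (hKsub : K ⊆ closedHalfPlane σ) {δ : ℝ}
    (hδ : 0 < δ) (h : ∀ E ∈ K, δ ≤ ‖zhukovskyInv σ E ^ 2 - 1‖) {E E₀ : ℂ} (hE : E ∈ K)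
    (hE₀ : E₀ ∈ K) : ‖zhukovskyInv σ E - zhukovskyInv σ E₀‖ ≤ 4 / δ * ‖E - E₀‖ := by
  obtain ⟨h0, h1, h2, h3⟩ := zhukovskyInv_spec σ (hKsub hE)
  obtain ⟨h0', h1', h2', h3'⟩ := zhukovskyInv_spec σ (hKsub hE₀)
  have hd := (h E hE).trans (norm_sq_sub_one_le h1 h1' h3 h3')
  generalize zhukovskyInv σ E = z at *
  generalize zhukovskyInv σ E₀ = w at *
  have e : (z - w) * (1 - z * w) = -((E - E₀) * (z * w)) := by
    rw [← h2, ← h2']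
    field_simp
    ring
  have e' : ‖z - w‖ * ‖1 - z * w‖ ≤ ‖E - E₀‖ := by
    rw [← norm_mul, e, norm_neg, norm_mul, norm_mul]
    exact mul_le_of_le_one_right (norm_nonneg _) (mul_le_one₀ h1 (norm_nonneg _) h1')
  rw [div_mul_eq_mul_div, le_div_iff₀ hδ]
  nlinarith [norm_nonneg (z - w)]

end Zhukovsky

/-! ### The Hilbert space of matrices -/

section MatrixSpace

variable {L : ℕ}

instance : FiniteDimensional ℂ (MatL L) :=
  inferInstanceAs (FiniteDimensional ℂ (Matrix (Fin L) (Fin L) ℂ))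

instance : CompleteSpace (MatL L) := FiniteDimensional.complete ℂ (MatL L)

/-- The Frobenius inner product on `M_L`. -/
noncomputable instance : InnerProductSpace ℂ (MatL L) where
  inner A B := ∑ i, ∑ j, (starRingEnd ℂ) (A i j) * B i j
  norm_sq_eq_re_inner A := by
    rw [MatL.norm_sq, map_sum]
    refine Finset.sum_congr rfl fun i _ => ?_
    rw [map_sum]
    refine Finset.sum_congr rfl fun j _ => ?_
    rw [mul_comm, Complex.mul_conj, Complex.normSq_eq_norm_sq]
    exact (Complex.ofReal_re _).symm
  conj_inner_symm A B := by
    rw [map_sum]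
    refine Finset.sum_congr rfl fun i _ => ?_
    rw [map_sum]
    refine Finset.sum_congr rfl fun j _ => ?_
    rw [map_mul, Complex.conj_conj, mul_comm]
  add_left A B C := by
    rw [← Finset.sum_add_distrib]
    refine Finset.sum_congr rfl fun i _ => ?_
    rw [← Finset.sum_add_distrib]
    refine Finset.sum_congr rfl fun j _ => ?_
    change (starRingEnd ℂ) (A i j + B i j) * _ = _
    rw [map_add, add_mul]
  smul_left A B c := by
    rw [Finset.mul_sum]
    refine Finset.sum_congr rfl fun i _ => ?_
    rw [Finset.mul_sum]
    refine Finset.sum_congr rfl fun j _ => ?_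
    change (starRingEnd ℂ) (c * A i j) * _ = _
    rw [map_mul, mul_assoc]

theorem MatL.inner_def (A B : MatL L) :
    inner ℂ A B = ∑ i, ∑ j, (starRingEnd ℂ) (A i j) * B i j := rfl

theorem inner_leftMul {A : MatL L} (hA : Matrix.IsHermitian (n := Fin L) (α := ℂ) A) (B C : MatL L) :
    inner ℂ (leftMul A B) C = inner ℂ B (leftMul A C) := by
  have e1 : inner ℂ (leftMul A B) C
      = ∑ i, ∑ j, ∑ k, A k i * (starRingEnd ℂ) (B k j) * C i j := by
    rw [MatL.inner_def]
    refine Finset.sum_congr rfl fun i _ => Finset.sum_congr rfl fun j _ => ?_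
    have h : leftMul A B i j = ∑ k, A i k * B k j :=
      Matrix.mul_apply (M := (A : Matrix (Fin L) (Fin L) ℂ))
    rw [h, map_sum, Finset.sum_mul]
    refine Finset.sum_congr rfl fun k _ => ?_
    rw [map_mul, ← hA.apply k i]
    rfl
  have e2 : inner ℂ B (leftMul A C)
      = ∑ k, ∑ j, ∑ i, A k i * (starRingEnd ℂ) (B k j) * C i j := by
    rw [MatL.inner_def]
    refine Finset.sum_congr rfl fun k _ => Finset.sum_congr rfl fun j _ => ?_
    have h : leftMul A C k j = ∑ i, A k i * C i j :=
      Matrix.mul_apply (M := (A : Matrix (Fin L) (Fin L) ℂ))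
    rw [h, Finset.mul_sum]
    refine Finset.sum_congr rfl fun i _ => ?_
    ring
  rw [e1, e2, Finset.sum_comm]
  conv_rhs => rw [Finset.sum_comm]
  refine Finset.sum_congr rfl fun j _ => ?_
  rw [Finset.sum_comm]

/-- The potential as a sequence of operators on `M_L`. -/
noncomputable def Potential.op (V : Potential L) (n : ℤ) : MatL L →L[ℂ] MatL L :=
  leftMul (V.toFun n)

theorem Potential.inner_op (V : Potential L) (n : ℤ) (A B : MatL L) :
    inner ℂ (V.op n A) B = inner ℂ A (V.op n B) := inner_leftMul (V.isHermitian n) A B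

end MatrixSpace

/-! ### From the Birman–Schwinger operator to the resolvent of `H` -/

section Resolvent

variable {L : ℕ}

theorem norm_shiftOp_le (k : ℤ) : ‖shiftOp L k‖ ≤ 1 :=
  LinearMap.mkContinuous_norm_le _ zero_le_one _

/-- The free resolvent on `ℓ²`, for `‖z‖ < 1`. -/
noncomputable def freeResolvent (L : ℕ) (z : ℂ) : EllTwo L →L[ℂ] EllTwo L :=
  ∑' k : ℤ, green z k • shiftOp L k

theorem hasSum_freeResolvent {z : ℂ} (hz : ‖z‖ < 1) (g : EllTwo L) (s : ℤ) :
    HasSum (fun r => green z (s - r) • g r) (freeResolvent L z g s) := by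
  have h1 : Summable fun k : ℤ => green z k • shiftOp L k :=
    .of_norm_bounded (summable_norm_green hz) fun k => by
      rw [norm_smul]
      exact mul_le_of_le_one_right (norm_nonneg _) (norm_shiftOp_le k)
  have h2 := (lp.evalCLM ℂ (fun _ : ℤ => MatL L) 2 s).hasSum
    ((ContinuousLinearMap.apply ℂ (EllTwo L) g).hasSum h1.hasSum)
  have h3 : HasSum (fun k => green z k • g (s + k)) (freeResolvent L z g s) := h2
  have e : (fun r => green z (s - r) • g r)
      = (fun k => green z k • g (s + k)) ∘ Equiv.subRight s := funext fun r => by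
    rw [Function.comp_apply, Equiv.subRight_apply, add_sub_cancel, ← green_neg, neg_sub]
  rw [e]
  exact (Equiv.subRight s).hasSum_iff.2 h3

theorem exists_ellTwo_eq_green_convolution {z : ℂ} (hz : ‖z‖ < 1)
    (f : lp (fun _ : ℤ => MatL L) 1) :
    ∃ U : EllTwo L, ∀ s, U s = ∑' r, green z (s - r) • f r :=
  ⟨freeResolvent L z ⟨f, (lp.memℓp f).of_exponent_ge (by norm_num)⟩, fun s =>
    (hasSum_freeResolvent hz _ s).tsum_eq.symm⟩

variable {V : Potential L} {θ α : ℝ} {z : ℂ}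

theorem Potential.summable_norm_op (V : Potential L) : Summable fun n => ‖V.op n‖ :=
  V.summable_norm

theorem exists_ellTwo_solution (hV : Summable fun n => wt n ^ θ * ‖V.op n‖) (hθ : 0 ≤ θ)
    (hz : ‖z‖ < 1) (h0 : z ≠ 0) (hz1 : z ^ 2 ≠ 1)
    (hu : IsUnit (1 + birmanSchwinger V.op hθ z)) (y : lp (fun _ : ℤ => MatL L) 1) :
    ∃ U : EllTwo L, (∀ s, U s = ∑' r, green z (s - r) •
        weightOp (MatL L) hθ (Ring.inverse (1 + birmanSchwinger V.op hθ z) y) r) ∧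
      ∀ s, (schrodinger V - algebraMap ℂ (EllTwo L →L[ℂ] EllTwo L) (z + 1 / z)) U s
        = weightOp (MatL L) hθ y s := by
  obtain ⟨U, hU⟩ := exists_ellTwo_eq_green_convolution hz
    (weightOp (MatL L) hθ (Ring.inverse (1 + birmanSchwinger V.op hθ z) y))
  refine ⟨U, hU, fun s => ?_⟩
  have h1 : (1 + birmanSchwinger V.op hθ z) (Ring.inverse (1 + birmanSchwinger V.op hθ z) y) = y :=
    DFunLike.congr_fun (Ring.mul_inverse_cancel _ hu) y
  have h2 := schrodinger_equation_of_birmanSchwinger hV hθ hz.le h0 hz1 h1 hU s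
  exact sub_eq_iff_eq_add'.2 h2

/-- The Birman–Schwinger inverse only handles right-hand sides in the weighted `ℓ¹` space. For `g ∈
ℓ²` the free solution `W = G g` leaves the error `V W`, which does lie in that space since `W` is
bounded; solving for it and subtracting gives surjectivity. -/
theorem isUnit_schrodinger_sub (hV : Summable fun n => wt n ^ θ * ‖V.op n‖) (hθ : 0 ≤ θ)
    (hz : ‖z‖ < 1) (h0 : z ≠ 0) (hz1 : z ^ 2 ≠ 1)
    (hu : IsUnit (1 + birmanSchwinger V.op hθ z)) (hp : z + 1 / z ∉ pointSpectrum V) :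
    IsUnit (schrodinger V - algebraMap ℂ (EllTwo L →L[ℂ] EllTwo L) (z + 1 / z)) := by
  rw [ContinuousLinearMap.isUnit_iff_bijective]
  refine ⟨(injective_iff_map_eq_zero _).2 fun u hu => ?_, fun g => ?_⟩
  · by_contra hne
    exact hp ⟨u, hne, sub_eq_zero.1 hu⟩
  · set W := freeResolvent L z g
    have hWs : ∀ s, W s = ∑' r, green z (s - r) • g r := fun s =>
      (hasSum_freeResolvent hz g s).tsum_eq.symm
    have hWeq : ∀ s, W (s + 1) + W (s - 1) = (z + 1 / z) • W s + g s := fun s => by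
      rw [hWs, hWs, hWs]
      exact green_convolution_equation h0 hz1 (fun s => (hasSum_freeResolvent hz g s).summable) s
    have hy : Summable fun s => ‖((wt s ^ θ : ℝ) : ℂ) • V.op s (W s)‖ := by
      refine .of_nonneg_of_le (fun s => norm_nonneg _) (fun s => ?_) (hV.mul_right ‖W‖)
      have h2 : 0 ≤ wt s ^ θ := Real.rpow_nonneg (wt_pos s).le _
      rw [norm_smul, norm_wt_rpow, mul_assoc]
      gcongr
      exact (V.op s).le_opNorm_of_le (lp.norm_apply_le_norm two_ne_zero W s)
    obtain ⟨U, -, hU⟩ := exists_ellTwo_solution hV hθ hz h0 hz1 hu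
      ⟨fun s => ((wt s ^ θ : ℝ) : ℂ) • V.op s (W s), memℓp_one_of_summable hy⟩
    refine ⟨W - U, lp.ext (funext fun s => ?_)⟩
    have h1 := hU s
    rw [weightOp_apply, smul_smul, ← Complex.ofReal_mul, wt_rpow_neg_mul_rpow,
      Complex.ofReal_one, one_smul] at h1
    rw [map_sub, lp.coeFn_sub, Pi.sub_apply, h1]
    have h2 : (schrodinger V - algebraMap ℂ (EllTwo L →L[ℂ] EllTwo L) (z + 1 / z)) W s
        = W (s + 1) + W (s - 1) + V.op s (W s) - (z + 1 / z) • W s := rfl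
    rw [h2, hWeq]
    abel

theorem weightedResolvent_apply (hθ : 0 ≤ θ) (hα : θ + 1 / 2 < α) (hz : ‖z‖ ≤ 1) (g : EllTwo L)
    (s : ℤ) : weightedResolvent V.op hθ hα z g s = ((wt s ^ (-α) : ℝ) : ℂ) •
      ∑' r, green z (s - r) • weightOp (MatL L) hθ
        (Ring.inverse (1 + birmanSchwinger V.op hθ z)
          (weightTwoOne (MatL L) (show θ - α < -(1 / 2) by linarith) g)) r :=
  weightedGreenOp_apply (by linarith) hz _ s

theorem weightOp_weightTwoOne (hθ : 0 ≤ θ) (hα : θ + 1 / 2 < α) (g : EllTwo L) (s : ℤ) :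
    weightOp (MatL L) hθ (weightTwoOne (MatL L) (show θ - α < -(1 / 2) by linarith) g) s
      = ((wt s ^ (-α) : ℝ) : ℂ) • g s := by
  rw [weightOp_apply, weightTwoOne_apply, smul_smul, ← Complex.ofReal_mul,
    ← Real.rpow_add (wt_pos s)]
  congr 4
  ring

theorem matrixElement_apply (T : EllTwo L →L[ℂ] EllTwo L) (s r : ℤ) (A : MatL L) :
    matrixElement T s r A = T (lp.single 2 r A) s := rfl

/-- A sequence supported at one site lies in both `ℓ²` and the weighted space, so the
Birman–Schwinger solution can be compared with the true resolvent; invertibility of `H - E` makes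
them agree. The powers `α` undo the weights. -/
theorem matrixElement_resolventOp (hV : Summable fun n => wt n ^ θ * ‖V.op n‖) (hθ : 0 ≤ θ)
    (hα : θ + 1 / 2 < α) (hz : ‖z‖ < 1) (h0 : z ≠ 0) (hz1 : z ^ 2 ≠ 1)
    (hu : IsUnit (1 + birmanSchwinger V.op hθ z)) (hp : z + 1 / z ∉ pointSpectrum V) (s r : ℤ) :
    matrixElement (resolventOp V (z + 1 / z)) s r
      = ((wt s ^ α * wt r ^ α : ℝ) : ℂ) • matrixElement (weightedResolvent V.op hθ hα z) s r := by
  refine ContinuousLinearMap.ext fun A => ?_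
  obtain ⟨U, hU1, hU2⟩ := exists_ellTwo_solution hV hθ hz h0 hz1 hu
    (weightTwoOne (MatL L) (show θ - α < -(1 / 2) by linarith) (lp.single 2 r A))
  have h1 : (schrodinger V - algebraMap ℂ (EllTwo L →L[ℂ] EllTwo L) (z + 1 / z)) U
      = ((wt r ^ (-α) : ℝ) : ℂ) • lp.single 2 r A := by
    refine lp.ext (funext fun n => ?_)
    rw [hU2, weightOp_weightTwoOne hθ hα, lp.coeFn_smul, Pi.smul_apply]
    by_cases h : n = r
    · rw [h]
    · rw [lp.single_apply_ne _ _ _ h, smul_zero, smul_zero]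
  have h2 : U = ((wt r ^ (-α) : ℝ) : ℂ) • resolventOp V (z + 1 / z) (lp.single 2 r A) := by
    rw [← map_smul, ← h1]
    exact (DFunLike.congr_fun (Ring.inverse_mul_cancel _
      (isUnit_schrodinger_sub hV hθ hz h0 hz1 hu hp)) U).symm
  rw [smul_apply, matrixElement_apply, matrixElement_apply, weightedResolvent_apply hθ hα hz.le,
    ← hU1, h2, lp.coeFn_smul, Pi.smul_apply, smul_smul, smul_smul, ← Complex.ofReal_mul,
    ← Complex.ofReal_mul]
  have h3 : wt s ^ α * wt r ^ α * (wt s ^ (-α) * wt r ^ (-α)) = 1 := by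
    have e1 := wt_rpow_neg_mul_rpow α s
    have e2 := wt_rpow_neg_mul_rpow α r
    linear_combination (wt r ^ (-α) * wt r ^ α) * e1 + e2
  rw [← mul_assoc] at h3
  rw [h3, Complex.ofReal_one, one_smul]

/-- `1 + V G` is invertible at the points of the closed half-plane outside the point spectrum and
the band edges. -/
theorem isUnit_one_add_birmanSchwinger_zhukovskyInv
    (hV : Summable fun n => wt n ^ θ * ‖V.op n‖) (hθ : 0 ≤ θ) {σ : ℤˣ} {E : ℂ}
    (hE : E ∈ closedHalfPlane σ \ (pointSpectrum V ∪ {-2, 2})) :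
    IsUnit (1 + birmanSchwinger V.op hθ (zhukovskyInv σ E)) := by
  have hE2 : E ≠ 2 := fun h => hE.2 (by simp [h])
  have hE2' : E ≠ -2 := fun h => hE.2 (by simp [h])
  have hEp : E ∉ pointSpectrum V := fun h => hE.2 (Or.inl h)
  obtain ⟨h0, h1, h2, -⟩ := zhukovskyInv_spec σ hE.1
  have hz1 := sq_ne_one_of_add_one_div h2 hE2 hE2'
  refine isUnit_one_add_birmanSchwinger hV hθ h1 h0 hz1 fun f u hu hfu heq => ?_
  -- Inside the disc `u` is square summable and would be an eigenvector; on the circle the absence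
  -- of resonances applies.
  rcases h1.lt_or_eq with hlt | hone
  · obtain ⟨U, hU⟩ := exists_ellTwo_eq_green_convolution hlt f
    have hUu : ∀ s, U s = u s := fun s => by rw [hU, hu]
    have hU0 : U = 0 := by
      by_contra hne
      refine hEp ⟨U, hne, lp.ext (funext fun s => ?_)⟩
      rw [schrodinger_apply, lp.coeFn_smul, Pi.smul_apply, hUu, hUu, hUu, ← h2]
      exact heq s
    intro s
    rw [← hUu, hU0]
    rfl
  · exact eq_zero_of_eq_neg_green_convolution V.inner_op V.summable_norm_op hone hz1
      (lp.summable_norm_one f) hu hfu heq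

theorem im_eq_zero_of_mem_pointSpectrum {E : ℂ} (hE : E ∈ pointSpectrum V) : E.im = 0 := by
  obtain ⟨u, hne, hu⟩ := hE
  by_contra him
  refine hne (lp.ext (funext fun n => ?_))
  refine eq_zero_of_summable_sq V.inner_op (fun n => ?_) him u.summable_sq n
  have := congrArg (fun v : EllTwo L => v n) hu
  simp only [schrodinger_apply, lp.coeFn_smul, Pi.smul_apply] at this
  exact this

theorem zhukovskyInv_resolvent {σ : ℤˣ} {E : ℂ} (hV : Summable fun n => wt n ^ θ * ‖V.op n‖)
    (hθ : 0 ≤ θ) (hα : θ + 1 / 2 < α) (hE : E ∈ closedHalfPlane σ \ (pointSpectrum V ∪ {-2, 2}))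
    (hband : E ∉ openBand) :
    E ∉ spectrum ℂ (schrodinger V) ∧ ∀ s r, matrixElement (resolventOp V E) s r
      = ((wt s ^ α * wt r ^ α : ℝ) : ℂ) •
        matrixElement (weightedResolvent V.op hθ hα (zhukovskyInv σ E)) s r := by
  have hE2 : E ≠ 2 := fun h => hE.2 (by simp [h])
  have hE2' : E ≠ -2 := fun h => hE.2 (by simp [h])
  have hEp : E ∉ pointSpectrum V := fun h => hE.2 (Or.inl h)
  have hcl : E ∉ closedBand := fun h => hband (mem_openBand_of_mem_closedBand h hE2 hE2')
  obtain ⟨h0, h1, h2, -⟩ := zhukovskyInv_of_notMem_closedBand σ hcl hE.1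
  have hz1 := sq_ne_one_of_add_one_div h2 hE2 hE2'
  have hu := isUnit_one_add_birmanSchwinger_zhukovskyInv hV hθ hE
  generalize zhukovskyInv σ E = z at *
  subst h2
  refine ⟨?_, matrixElement_resolventOp hV hθ hα h1 h0 hz1 hu hEp⟩
  rw [spectrum.notMem_iff, ← IsUnit.neg_iff, neg_sub]
  exact isUnit_schrodinger_sub hV hθ h1 h0 hz1 hu hEp

theorem exists_weightedResolvent_holder {σ : ℤˣ} {K : Set ℂ}
    (hV : Summable fun n => wt n ^ θ * ‖V.op n‖) (hθ : 0 < θ) (hθ1 : θ ≤ 1)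
    (hα : θ + 1 / 2 < α) (hK : IsCompact K)
    (hKsub : K ⊆ closedHalfPlane σ \ (pointSpectrum V ∪ {-2, 2})) :
    ∃ C C' : ℝ, 0 ≤ C ∧ 0 ≤ C' ∧ ∀ E ∈ K, ∀ E₀ ∈ K,
      ‖weightedResolvent V.op hθ.le hα (zhukovskyInv σ E)
          - weightedResolvent V.op hθ.le hα (zhukovskyInv σ E₀)‖
        ≤ C * ‖zhukovskyInv σ E - zhukovskyInv σ E₀‖ ^ θ ∧
      ‖weightedResolvent V.op hθ.le hα (zhukovskyInv σ E)
          - weightedResolvent V.op hθ.le hα (zhukovskyInv σ E₀)‖ ≤ C' * ‖E - E₀‖ ^ θ := by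
  have hK1 : K ⊆ closedHalfPlane σ := fun E hE => (hKsub hE).1
  have hK2 : ∀ E ∈ K, E ≠ 2 ∧ E ≠ -2 := fun E hE =>
    ⟨fun h => (hKsub hE).2 (by simp [h]), fun h => (hKsub hE).2 (by simp [h])⟩
  obtain ⟨δ, hδ, hKδ⟩ := exists_le_norm_zhukovskyInv_sq_sub_one hK hK1 hK2
  have hlip := fun E hE E₀ hE₀ => norm_zhukovskyInv_sub_le hK1 hδ hKδ (E := E) (E₀ := E₀) hE hE₀
  have hcont : ContinuousOn (zhukovskyInv σ) K := by
    refine (LipschitzOnWith.of_dist_le_mul (K := (4 / δ).toNNReal) fun E hE E₀ hE₀ => ?_).continuousOn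
    rw [dist_eq_norm, dist_eq_norm, Real.coe_toNNReal _ (by positivity)]
    exact hlip E hE E₀ hE₀
  set S := zhukovskyInv σ '' K
  have hSc : IsCompact S := hK.image_of_continuousOn hcont
  have hS1 : ∀ z ∈ S, ‖z‖ ≤ 1 := by
    rintro _ ⟨E, hE, rfl⟩
    exact (zhukovskyInv_spec σ (hK1 hE)).2.1
  have hSδ : ∀ z ∈ S, δ ≤ ‖z ^ 2 - 1‖ := by
    rintro _ ⟨E, hE, rfl⟩
    exact hKδ E hE
  have hSu : ∀ z ∈ S, IsUnit (1 + birmanSchwinger V.op hθ.le z) := by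
    rintro _ ⟨E, hE, rfl⟩
    exact isUnit_one_add_birmanSchwinger_zhukovskyInv hV hθ.le (hKsub hE)
  have hSm : ContinuousOn (fun z => Ring.inverse (1 + birmanSchwinger V.op hθ.le z)) S := by
    -- Inversion is continuous at units of a Banach algebra; compactness of `S` then bounds the
    -- inverses uniformly.
    intro z hz
    have h1 := NormedRing.inverse_continuousAt (hSu z hz).unit
    have h2 : ContinuousWithinAt (fun z => 1 + birmanSchwinger V.op hθ.le z) S z :=
      continuousWithinAt_const.add (continuousOn_birmanSchwinger hV hθ hθ1 hδ hS1 hSδ z hz)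
    exact ContinuousAt.comp_continuousWithinAt
      (f := fun z => 1 + birmanSchwinger V.op hθ.le z) h1 h2
  obtain ⟨m, hm⟩ := hSc.exists_bound_of_continuousOn hSm
  obtain ⟨C, hC0, hC⟩ := exists_norm_weightedResolvent_sub_le hV hθ.le hθ1 hα hδ hS1 hSδ hSu hm
  refine ⟨C, C * (4 / δ) ^ θ, hC0, by positivity, fun E hE E₀ hE₀ => ?_⟩
  have h1 := hC _ (Set.mem_image_of_mem _ hE) _ (Set.mem_image_of_mem _ hE₀)
  refine ⟨h1, h1.trans ?_⟩
  rw [mul_assoc, ← Real.mul_rpow (by positivity) (norm_nonneg _)]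
  gcongr
  exact hlip E hE E₀ hE₀

theorem offAxis_im (σ : ℤˣ) (E : ℂ) (ε : ℝ) :
    (offAxis σ E ε).im = E.im + ((σ : ℤ) : ℝ) * ε := by
  simp [offAxis]

theorem offAxis_mem {σ : ℤˣ} {E : ℂ} (hE : E ∈ openBand) {ε : ℝ} (hε : 0 < ε) :
    offAxis σ E ε ∈ closedHalfPlane σ \ (pointSpectrum V ∪ {-2, 2}) ∧
      offAxis σ E ε ∉ openBand := by
  have him : (offAxis σ E ε).im = ((σ : ℤ) : ℝ) * ε := by rw [offAxis_im, hE.1, zero_add]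
  have hne : (offAxis σ E ε).im ≠ 0 := by
    rw [him]
    rcases Int.units_eq_one_or σ with rfl | rfl <;> simpa using hε.ne'
  refine ⟨⟨?_, ?_⟩, fun h => hne h.1⟩
  · change 0 ≤ ((σ : ℤ) : ℝ) * (offAxis σ E ε).im
    rw [him]
    rcases Int.units_eq_one_or σ with rfl | rfl <;> simpa using hε.le
  · rintro (h | h | h)
    · exact hne (im_eq_zero_of_mem_pointSpectrum h)
    · exact hne (by rw [h]; simp)
    · exact hne (by rw [h]; simp)

theorem continuous_matrixElement (s r : ℤ) :
    Continuous fun T : EllTwo L →L[ℂ] EllTwo L => matrixElement T s r :=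
  continuous_const.clm_comp (continuous_id.clm_comp continuous_const)

theorem tendsto_matrixElement_resolventOp {σ : ℤˣ} {E : ℂ}
    (hV : Summable fun n => wt n ^ θ * ‖V.op n‖) (hθ : 0 < θ) (hθ1 : θ ≤ 1) (hα : θ + 1 / 2 < α)
    (hE : E ∈ closedHalfPlane σ \ (pointSpectrum V ∪ {-2, 2})) (hband : E ∈ openBand) (s r : ℤ) :
    Tendsto (fun ε : ℝ => matrixElement (resolventOp V (offAxis σ E ε)) s r) (𝓝[>] 0)
      (𝓝 (((wt s ^ α * wt r ^ α : ℝ) : ℂ) •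
        matrixElement (weightedResolvent V.op hθ.le hα (zhukovskyInv σ E)) s r)) := by
  have hoff : Continuous (offAxis σ E) := by
    unfold offAxis
    fun_prop
  have hoff0 : offAxis σ E 0 = E := by simp [offAxis]
  -- The segment from `E` into the half-plane is itself an admissible compact set, so its Hölder
  -- estimate gives the boundary value as a norm limit of weighted resolvents.
  have hK : IsCompact (offAxis σ E '' Set.Icc 0 1) := isCompact_Icc.image hoff
  have hKsub : offAxis σ E '' Set.Icc 0 1 ⊆ closedHalfPlane σ \ (pointSpectrum V ∪ {-2, 2}) := by
    rintro _ ⟨ε, hε, rfl⟩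
    rcases hε.1.eq_or_lt with h | h
    · rw [← h, hoff0]
      exact hE
    · exact (offAxis_mem hband h).1
  obtain ⟨_, C, _, _, hC⟩ := exists_weightedResolvent_holder hV hθ hθ1 hα hK hKsub
  have hlim : Tendsto (fun ε : ℝ => weightedResolvent V.op hθ.le hα (zhukovskyInv σ (offAxis σ E ε)))
      (𝓝[>] 0) (𝓝 (weightedResolvent V.op hθ.le hα (zhukovskyInv σ E))) := by
    rw [tendsto_iff_norm_sub_tendsto_zero]
    have hg : Continuous fun ε : ℝ => C * ‖offAxis σ E ε - E‖ ^ θ :=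
      continuous_const.mul ((hoff.sub continuous_const).norm.rpow_const fun _ => Or.inr hθ.le)
    have hg0 := (hg.tendsto 0).mono_left (nhdsWithin_le_nhds (s := Set.Ioi 0))
    rw [hoff0, sub_self, norm_zero, Real.zero_rpow hθ.ne', mul_zero] at hg0
    refine squeeze_zero' (.of_forall fun _ => norm_nonneg _) ?_ hg0
    filter_upwards [Ioc_mem_nhdsGT one_pos] with ε hε
    exact (hC _ ⟨ε, ⟨hε.1.le, hε.2⟩, rfl⟩ E ⟨0, by simp, hoff0⟩).2
  refine ((((continuous_matrixElement s r).tendsto _).comp hlim).const_smul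
    ((wt s ^ α * wt r ^ α : ℝ) : ℂ)).congr' ?_
  filter_upwards [self_mem_nhdsWithin] with ε hε
  obtain ⟨h1, h2⟩ := offAxis_mem (V := V) (σ := σ) hband hε
  exact ((zhukovskyInv_resolvent hV hθ.le hα h1 h2).2 s r).symm

theorem resolventKernel_eq {σ : ℤˣ} {E : ℂ}
    (hV : Summable fun n => wt n ^ θ * ‖V.op n‖) (hθ : 0 < θ) (hθ1 : θ ≤ 1) (hα : θ + 1 / 2 < α)
    (hE : E ∈ closedHalfPlane σ \ (pointSpectrum V ∪ {-2, 2})) (s r : ℤ) :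
    resolventKernel V σ E s r = ((wt s ^ α * wt r ^ α : ℝ) : ℂ) •
        matrixElement (weightedResolvent V.op hθ.le hα (zhukovskyInv σ E)) s r := by
  by_cases h : E ∈ openBand
  · rw [resolventKernel, if_pos h]
    exact (tendsto_matrixElement_resolventOp hV hθ hθ1 hα hE h s r).limUnder_eq
  · rw [resolventKernel, if_neg h]
    exact (zhukovskyInv_resolvent hV hθ.le hα hE h).2 s r

theorem isWeightedResolvent_of_kernel_eq {σ : ℤˣ} {E : ℂ} {B : EllTwo L →L[ℂ] EllTwo L}
    (h : ∀ s r, resolventKernel V σ E s r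
      = ((wt s ^ α * wt r ^ α : ℝ) : ℂ) • matrixElement B s r) :
    IsWeightedResolvent V σ α E B := by
  intro u
  have key : ∀ s, HasSum (fun r => resolventKernel V σ E s r (weight α u r))
      (((wt s ^ α : ℝ) : ℂ) • B u s) := fun s => by
    have h1 := (lp.hasSum_clm_single (by norm_num)
      ((lp.evalCLM ℂ (fun _ : ℤ => MatL L) 2 s).comp B) u).const_smul ((wt s ^ α : ℝ) : ℂ)
    have e : (fun r => resolventKernel V σ E s r (weight α u r)) = fun r =>
        ((wt s ^ α : ℝ) : ℂ) • ((lp.evalCLM ℂ (fun _ : ℤ => MatL L) 2 s).comp B)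
          (lp.single 2 r (u r)) := funext fun r => by
      have h2 : weight α u r = ((wt r ^ (-α) : ℝ) : ℂ) • u r := (Complex.coe_smul _ _).symm
      have h3 : wt s ^ α * wt r ^ α * wt r ^ (-α) = wt s ^ α := by
        linear_combination (wt s ^ α) * wt_rpow_neg_mul_rpow α r
      rw [h, h2, map_smul, smul_apply, smul_smul, ← Complex.ofReal_mul, mul_comm (wt r ^ (-α)), h3]
      rfl
    rw [e]
    exact h1
  -- The expansion of `u` in single-site sequences converges unconditionally; in the
  -- finite-dimensional `M_L` this is absolute convergence, as the domain requires.
  refine ⟨fun s => summable_norm_iff.2 (key s).summable, funext fun s => ?_⟩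
  change B u s = (1 + |(s : ℝ)|) ^ (-α) • ∑' r, resolventKernel V σ E s r (weight α u r)
  rw [(key s).tsum_eq, ← Complex.coe_smul, smul_smul, ← Complex.ofReal_mul]
  have h4 : (1 + |(s : ℝ)|) ^ (-α) * wt s ^ α = 1 := wt_rpow_neg_mul_rpow α s
  rw [h4, Complex.ofReal_one, one_smul]

theorem Potential.HasMoment.summable_wt {V : Potential L} {ρ θ : ℝ} (h : V.HasMoment ρ)
    (hθ : θ ≤ ρ) : Summable fun n => wt n ^ θ * ‖V.op n‖ := by
  refine .of_nonneg_of_le (fun n => ?_) (fun n => ?_) h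
  · have := Real.rpow_nonneg (wt_pos n).le θ
    positivity
  · exact mul_le_mul_of_nonneg_right (Real.rpow_le_rpow_of_exponent_le (one_le_wt n) hθ)
      (norm_nonneg _)

theorem holderOnWith_of_norm_sub_le {X : Type*} [NormedAddCommGroup X] {f : ℂ → X} {K : Set ℂ}
    {C θ : ℝ} (hC : 0 ≤ C) (hθ : 0 ≤ θ) (h : ∀ x ∈ K, ∀ y ∈ K, ‖f x - f y‖ ≤ C * ‖x - y‖ ^ θ) :
    HolderOnWith C.toNNReal θ.toNNReal f K := by
  intro x hx y hy
  rw [edist_dist, edist_dist, Real.coe_toNNReal θ hθ,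
    ENNReal.ofReal_rpow_of_nonneg dist_nonneg hθ, ← ENNReal.ofReal_coe_nnreal,
    Real.coe_toNNReal C hC, ← ENNReal.ofReal_mul hC, dist_eq_norm, dist_eq_norm]
  exact ENNReal.ofReal_le_ofReal (h x hx y hy)

end Resolvent

/-! ### The limiting absorption principle -/

theorem theorem2p5 (L : ℕ) (V : Potential L) (ρ α : ℝ) (hρ : 0 < ρ) (hV : V.HasMoment ρ)
    (hα : ρ + 1 / 2 < α) (σ : ℤˣ) (K : Set ℂ) (hK : IsCompact K)
    (hKsub : K ⊆ closedHalfPlane σ \ (pointSpectrum V ∪ {-2, 2})) :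
    -- the kernel is well defined on `K`: the resolvent exists at the points of `K` outside
    -- `(-2, 2)`, and near the points of `K` in `(-2, 2)` the boundary values exist
    (∀ E ∈ K, E ∉ openBand → E ∉ spectrum ℂ (schrodinger V)) ∧
    (∀ E ∈ K, E ∈ openBand →
      (∀ ε : ℝ, 0 < ε → offAxis σ E ε ∉ spectrum ℂ (schrodinger V)) ∧
      ∀ s r : ℤ, Tendsto (fun ε : ℝ => matrixElement (resolventOp V (offAxis σ E ε)) s r)
        (𝓝[>] 0) (𝓝 (resolventKernel V σ E s r))) ∧
    -- the map `E ↦ T_{-α} R_H^±(E) T_{-α}` into the bounded operators, and its Hölder continuity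
    ∃ B : ℂ → (EllTwo L →L[ℂ] EllTwo L),
      (∀ E ∈ K, IsWeightedResolvent V σ α E (B E)) ∧
      (∃ C : ℝ, ∀ E ∈ K, ∀ E₀ ∈ K,
        ‖B E - B E₀‖ ≤ C * ‖zhukovskyInv σ E - zhukovskyInv σ E₀‖ ^ min ρ 1) ∧
      (∃ C : NNReal, HolderOnWith C (min ρ 1).toNNReal B K) := by
  -- The working exponent is `θ = min ρ 1`: at most `ρ` for the moment of `V`, at most `1` for the
  -- interpolation of `green`.
  have hθ : 0 < min ρ 1 := lt_min hρ one_pos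
  have hθ1 : min ρ 1 ≤ 1 := min_le_right _ _
  have hαθ : min ρ 1 + 1 / 2 < α := by linarith [min_le_left ρ 1]
  have hVθ := hV.summable_wt (min_le_left ρ 1)
  obtain ⟨C, C', hC, hC', hholder⟩ :=
    exists_weightedResolvent_holder hVθ hθ hθ1 hαθ hK hKsub
  refine ⟨fun E hE hband => (zhukovskyInv_resolvent hVθ hθ.le hαθ (hKsub hE) hband).1,
    fun E hE hband => ⟨fun ε hε => ?_, fun s r => ?_⟩,
    fun E => weightedResolvent V.op hθ.le hαθ (zhukovskyInv σ E),
    fun E hE => isWeightedResolvent_of_kernel_eq (resolventKernel_eq hVθ hθ hθ1 hαθ (hKsub hE)),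
    ⟨C, fun E hE E₀ hE₀ => (hholder E hE E₀ hE₀).1⟩,
    C'.toNNReal, holderOnWith_of_norm_sub_le hC' hθ.le fun E hE E₀ hE₀ => (hholder E hE E₀ hE₀).2⟩
  · obtain ⟨h1, h2⟩ := offAxis_mem (V := V) (σ := σ) hband hε
    exact (zhukovskyInv_resolvent hVθ hθ.le hαθ h1 h2).1
  · rw [resolventKernel_eq hVθ hθ hθ1 hαθ (hKsub hE)]
    exact tendsto_matrixElement_resolventOp hVθ hθ hθ1 hαθ (hKsub hE) hband s r
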